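/- **Lemma 3.4.** Let $d\in\mathbb N$, $1<p<\infty$, and let $\theta\in C_c^\infty(\mathbb R^{d+1};\mathbb R^{d+1})$ satisfy $\theta=\mathrm{Id}$ in $B(0,1)$ and $\theta=0$ outside $B(0,2)$ (open balls). There is a constant $C$ depending only on $d$, $p$ and $\theta$ such that the following holds. Let $(N,h)$ be an oriented smooth $(d+1)$-dimensional Riemannian manifold and let $\varepsilon\in(0,1)$. Let $(U,\varphi)$ be an $\varepsilon$-isometric chart on $N$, that is, $\frac1{1+\varepsilon}|v|^2<h_y(v,v)<(1+\varepsilon)|v|^2$ for all $y\in\varphi(U)$ and $v\neq0$, where $h_y$ is the metric pushed forward by $\varphi$, and the Christoffel symbols of $h$ in this chart satisfy $|\Gamma_{ij}^k|\le\varepsilon$. Let $r>0$ with $B(0,2r)\subset\varphi(U)$ and set $\varphi^{(r)}:=r\,\theta(\varphi/r)$ in $U$, $\varphi^{(r)}:=0$ in $N\setminus U$. Let $Q\subset\mathbb R^d$ be an open and bounded cube. A map $w$ from $Q$ to a smooth manifold $X$ has the colocal weak derivative $dw$, where $dw_x:\mathbb R^d\to T_{w(x)}X$ is linear for $x \in Q$,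 if for every $f\in C^1_c(X)$ the function $f\circ w$ is weakly differentiable on $Q$ with weak derivative $df_{w(x)}\circ dw_x$ for a.e. $x \in Q$. Let $u\in\mathrm{Imm}_p(Q;N)$. This means that $u:Q\to N$ has a colocal weak derivative $du$ with $|du|_{e_d,h}\in L^p(Q)$ and $\operatorname{rank}du_x=d$ for a.e. $x$, and that the oriented unit normal $\nu_u:Q\to TN$ has a colocal weak derivative $d\nu_u$ whose norm with respect to the Euclidean metric and the Sasaki metric of $TN$ belongs to $L^p(Q)$. Here, if $\operatorname{rank}du_x=d$, then $\nu_u(x)\in T_{u(x)}N$ is the unit vector orthogonal to $du_x(\mathbb R^d)$ such that $(du_x(v_1),\dots,du_x(v_d),\nu_u(x))$ is a positively oriented basis of $T_{u(x)}N$ whenever $(v_1,\dots,v_d)$ is a positively oriented basis of $\mathbb R^d$; otherwise $\nu_u(x)=0$. The Sasaki norm is $|\xi|_\sigma^2=|d\pi_N(\xi)|_h^2+|K_{TN}(\xi)|_h^2$, where $\pi_N:TN\to N$ is the bundle projection and $K_{TN}:TTN\to TN$ is the connector of the Levi-Civita connection. All norms of linear maps are Frobenius norms, and $e_d$ is the Euclidean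 metric on $\mathbb R^d$. Set $$\tilde n(x):=D\varphi^{(r)}(u(x))(\nu_u(x)),\qquad F:=u^{-1}(\varphi^{-1}(B(0,r))),\qquad E_b(u):=\int_Q|K_{TN}\circ d(\nu_u)_x|_{e_d,h}^p\,dx .$$ Then $\tilde n\in W^{1,p}(Q;\mathbb R^{d+1})$ and $$\int_Q|D\tilde n|^p\,dx\le C\left(\frac1{r^p}\int_{Q\setminus F}|du|_{e_d,h}^p\,dx+\int_Q|du|_{e_d,h}^p\,dx+E_b(u)\right).$$ -/

import Mathlib

open MeasureTheory Set Bundle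
open scoped Manifold ContDiff ENNReal NNReal Topology

universe u

/-! ## Weak derivatives on open subsets of Euclidean space -/

/-- `g` is a weak (distributional) derivative of `f` on the open set `Q ⊆ ℝᵈ`: both are locally
integrable on `Q` and `∫_Q (∂_v η) f = - ∫_Q η (g v)` for all test functions `η ∈ C_c^∞(Q)` and all
directions `v`. -/
def HasWeakDeriv {d : ℕ} {F : Type*} [NormedAddCommGroup F] [NormedSpace ℝ F]
    (Q : Set (EuclideanSpace ℝ (Fin d))) (f : EuclideanSpace ℝ (Fin d) → F)
    (g : EuclideanSpace ℝ (Fin d) → EuclideanSpace ℝ (Fin d) →L[ℝ] F) : Prop :=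
  LocallyIntegrableOn f Q volume ∧ LocallyIntegrableOn g Q volume ∧
    ∀ η : EuclideanSpace ℝ (Fin d) → ℝ, ContDiff ℝ ∞ η → HasCompactSupport η → tsupport η ⊆ Q →
      ∀ v : EuclideanSpace ℝ (Fin d),
        ∫ x in Q, fderiv ℝ η x v • f x = - ∫ x in Q, η x • g x v

/-- Open bounded cubes in `ℝᵈ` (of side length `ℓ`, not necessarily parallel to the axes). -/
def IsOpenCube {d : ℕ} (Q : Set (EuclideanSpace ℝ (Fin d))) : Prop :=
  ∃ (b : OrthonormalBasis (Fin d) ℝ (EuclideanSpace ℝ (Fin d))) (c : EuclideanSpace ℝ (Fin d))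
    (ℓ : ℝ), 0 < ℓ ∧ Q = {x | ∀ i, |inner ℝ (b i) (x - c)| < ℓ / 2}

/-- The Frobenius norm `(∑ᵢ |L eᵢ|²)^(1/2)` of a linear map `L` from Euclidean `ℝᵈ` to a space with
norm `nrm`, where `(eᵢ)` is the standard basis. -/
noncomputable def frobeniusNorm {d : ℕ} {W : Type*} (nrm : W → ℝ)
    (L : EuclideanSpace ℝ (Fin d) → W) : ℝ :=
  √(∑ i, nrm (L (EuclideanSpace.single i 1)) ^ 2)

/-! ## Colocally weakly differentiable maps -/

/-- `du` is a colocal weak derivative on the open set `Q ⊆ ℝᵈ` of the map `u` with values in the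
manifold `N`: for every `f ∈ C_c^1(N)`, the function `f ∘ u` is weakly differentiable on `Q`, with
weak derivative `x ↦ df_{u(x)} ∘ du_x`. (Only the values of `u` and `du` on `Q` matter.) -/
def IsColocalWeakDeriv {d : ℕ} {E : Type*} [NormedAddCommGroup E] [NormedSpace ℝ E]
    {H : Type*} [TopologicalSpace H] (I : ModelWithCorners ℝ E H)
    {N : Type*} [TopologicalSpace N] [ChartedSpace H N]
    (Q : Set (EuclideanSpace ℝ (Fin d))) (u : EuclideanSpace ℝ (Fin d) → N)
    (du : ∀ x, EuclideanSpace ℝ (Fin d) →L[ℝ] TangentSpace I (u x)) : Prop :=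
  ∀ f : N → ℝ, ContMDiff I 𝓘(ℝ, ℝ) 1 f → HasCompactSupport f →
    HasWeakDeriv Q (fun x => f (u x))
      (fun x => ContinuousLinearMap.comp
        (show TangentSpace I (u x) →L[ℝ] ℝ from mfderiv I 𝓘(ℝ, ℝ) f (u x)) (du x))

/-! ## Orientations -/

/-- The family `v` is a basis of `V` that is positively oriented with respect to `o`. -/
def IsPositiveFrame {n : ℕ} {V : Type*} [AddCommGroup V] [Module ℝ V]
    (o : Orientation ℝ V (Fin n)) (v : Fin n → V) : Prop :=
  ∃ B : Module.Basis (Fin n) ℝ V, ⇑B = v ∧ B.orientation = o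

/-- The standard orientation of `ℝᵈ`. -/
noncomputable def stdOrientation (d : ℕ) : Orientation ℝ (EuclideanSpace ℝ (Fin d)) (Fin d) :=
  (EuclideanSpace.basisFun (Fin d) ℝ).toBasis.orientation

section Manifold

variable {d : ℕ} {N : Type u} [TopologicalSpace N]
  [ChartedSpace (EuclideanSpace ℝ (Fin (d + 1))) N]

variable (d N) in
/-- An orientation of the `(d + 1)`-dimensional manifold `N`: an orientation of every tangent space
such that every point lies in the domain of a chart all of whose coordinate frames are positive. -/
structure ManifoldOrientation where
  /-- The orientation of each tangent space. -/
  at_ : ∀ q : N, Orientation ℝ (TangentSpace (𝓡 (d + 1)) q) (Fin (d + 1))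
  exists_chart : ∀ q : N, ∃ φ ∈ IsManifold.maximalAtlas (𝓡 (d + 1)) ∞ N, q ∈ φ.source ∧
    ∀ q' ∈ φ.source, ∃ B : Module.Basis (Fin (d + 1)) ℝ (TangentSpace (𝓡 (d + 1)) q'),
      (∀ i, mfderiv (𝓡 (d + 1)) 𝓘(ℝ, EuclideanSpace ℝ (Fin (d + 1))) φ q' (B i)
        = EuclideanSpace.single i (1 : ℝ)) ∧ B.orientation = at_ q'

variable [RiemannianBundle (fun q : N => TangentSpace (𝓡 (d + 1)) q)]

/-- The Frobenius norm `|L|_{e_d, h}` of a linear map `L : ℝᵈ → T_qN`, with respect to the Euclidean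
metric on `ℝᵈ` and the Riemannian metric `h` on `T_qN`. -/
noncomputable def derivNorm {q : N}
    (L : EuclideanSpace ℝ (Fin d) →L[ℝ] TangentSpace (𝓡 (d + 1)) q) : ℝ :=
  frobeniusNorm (fun t : TangentSpace (𝓡 (d + 1)) q => ‖t‖) L

/-! ## Metric and Christoffel symbols in a chart, the connector, the Sasaki norm -/

/-- The metric of `N` pushed forward by the chart `φ`:
`h_y(v, w) = (d(φ⁻¹)_y v, d(φ⁻¹)_y w)_h` for `y` in the image of `φ`. -/
noncomputable def chartMetric (φ : OpenPartialHomeomorph N (EuclideanSpace ℝ (Fin (d + 1))))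
    (y v w : EuclideanSpace ℝ (Fin (d + 1))) : ℝ :=
  (inner ℝ
    (show TangentSpace (𝓡 (d + 1)) (φ.symm y) from
      mfderiv 𝓘(ℝ, EuclideanSpace ℝ (Fin (d + 1))) (𝓡 (d + 1)) φ.symm y v)
    (show TangentSpace (𝓡 (d + 1)) (φ.symm y) from
      mfderiv 𝓘(ℝ, EuclideanSpace ℝ (Fin (d + 1))) (𝓡 (d + 1)) φ.symm y w) : ℝ)

/-- The Gram matrix `(h_ij(y))` of the metric in the chart `φ`. -/
noncomputable def chartGram (φ : OpenPartialHomeomorph N (EuclideanSpace ℝ (Fin (d + 1))))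
    (y : EuclideanSpace ℝ (Fin (d + 1))) : Matrix (Fin (d + 1)) (Fin (d + 1)) ℝ :=
  Matrix.of fun i j => chartMetric φ y (EuclideanSpace.single i 1) (EuclideanSpace.single j 1)

/-- The partial derivative `∂_i h_jl` at `y` of the metric coefficients in the chart `φ`. -/
noncomputable def chartGramDeriv (φ : OpenPartialHomeomorph N (EuclideanSpace ℝ (Fin (d + 1))))
    (y : EuclideanSpace ℝ (Fin (d + 1))) (i j l : Fin (d + 1)) : ℝ :=
  fderiv ℝ (fun z => chartGram φ z j l) y (EuclideanSpace.single i 1)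

/-- The Christoffel symbol `Γ_{ij}^k = ½ ∑_l h^{kl} (∂_i h_jl + ∂_j h_il - ∂_l h_ij)` of the
Levi-Civita connection in the chart `φ`, at the point with coordinates `y`. -/
noncomputable def christoffel (φ : OpenPartialHomeomorph N (EuclideanSpace ℝ (Fin (d + 1))))
    (y : EuclideanSpace ℝ (Fin (d + 1))) (i j k : Fin (d + 1)) : ℝ :=
  (1 / 2) * ∑ l, (chartGram φ y)⁻¹ k l *
    (chartGramDeriv φ y i j l + chartGramDeriv φ y j i l - chartGramDeriv φ y l i j)

variable [IsManifold (𝓡 (d + 1)) ∞ N]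

/-- The differential of the bundle projection `TN → N`. -/
noncomputable def dProj (e : TangentBundle (𝓡 (d + 1)) N) (ξ : TangentSpace (𝓡 (d + 1)).tangent e) :
    TangentSpace (𝓡 (d + 1)) e.proj :=
  mfderiv (𝓡 (d + 1)).tangent (𝓡 (d + 1))
    (fun e' : TangentBundle (𝓡 (d + 1)) N => e'.proj) e ξ

/-- The connector `K_TN : T_{(q,v)}TN → T_qN`, computed in the chart `φ` around `q`. If `(y, w)` are
the coordinates on `TN` induced by `φ` (so `w(q', v') = dφ_{q'} v'`) and
`ξ = ∑ Y_i ∂/∂y_i + ∑ W_i ∂/∂w_i`, then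
`K_TN ξ = ∑_k (W_k + ∑_{i,j} w_j Y_i Γ_{ij}^k) ∂/∂y_k`. -/
noncomputable def connectorIn (φ : OpenPartialHomeomorph N (EuclideanSpace ℝ (Fin (d + 1))))
    (e : TangentBundle (𝓡 (d + 1)) N) (ξ : TangentSpace (𝓡 (d + 1)).tangent e) :
    TangentSpace (𝓡 (d + 1)) e.proj :=
  let w : TangentBundle (𝓡 (d + 1)) N → EuclideanSpace ℝ (Fin (d + 1)) := fun e' =>
    mfderiv (𝓡 (d + 1)) 𝓘(ℝ, EuclideanSpace ℝ (Fin (d + 1))) φ e'.proj e'.snd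
  let Y : EuclideanSpace ℝ (Fin (d + 1)) :=
    mfderiv (𝓡 (d + 1)) 𝓘(ℝ, EuclideanSpace ℝ (Fin (d + 1))) φ e.proj (dProj e ξ)
  let W : EuclideanSpace ℝ (Fin (d + 1)) :=
    mfderiv (𝓡 (d + 1)).tangent 𝓘(ℝ, EuclideanSpace ℝ (Fin (d + 1))) w e ξ
  mfderiv 𝓘(ℝ, EuclideanSpace ℝ (Fin (d + 1))) (𝓡 (d + 1)) φ.symm (φ e.proj)
    (WithLp.toLp 2 fun k => W k + ∑ i, ∑ j, w e j * Y i * christoffel φ (φ e.proj) i j k)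

/-- The connector `K_TN` of the Levi-Civita connection of `N`. It does not depend on the chart used
to compute it; we take the preferred chart at the base point. -/
noncomputable def connector (e : TangentBundle (𝓡 (d + 1)) N)
    (ξ : TangentSpace (𝓡 (d + 1)).tangent e) : TangentSpace (𝓡 (d + 1)) e.proj :=
  connectorIn (chartAt (EuclideanSpace ℝ (Fin (d + 1))) e.proj) e ξ

/-- The norm `(|dπ ξ|² + |K_TN ξ|²)^(1/2)` of the Sasaki metric on `TN`. -/
noncomputable def sasakiNorm (e : TangentBundle (𝓡 (d + 1)) N)
    (ξ : TangentSpace (𝓡 (d + 1)).tangent e) : ℝ :=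
  √(‖dProj e ξ‖ ^ 2 + ‖connector e ξ‖ ^ 2)

/-! ## Sobolev immersions -/

/-- `n` is the oriented unit normal of the linear map `L : ℝᵈ → T_qN`: if `L` has rank `d`, then `n`
is the unit vector orthogonal to the image of `L` that completes the image of any positively
oriented basis of `ℝᵈ` to a positively oriented basis of `T_qN`; otherwise `n = 0`. -/
def IsOrientedUnitNormal (o : ManifoldOrientation d N) {q : N}
    (L : EuclideanSpace ℝ (Fin d) →L[ℝ] TangentSpace (𝓡 (d + 1)) q)
    (n : TangentSpace (𝓡 (d + 1)) q) : Prop :=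
  (Module.finrank ℝ (LinearMap.range L.toLinearMap) = d →
    ‖n‖ = 1 ∧ (∀ v, inner ℝ n (L v) = (0 : ℝ)) ∧
      ∀ b : Fin d → EuclideanSpace ℝ (Fin d), IsPositiveFrame (stdOrientation d) b →
        IsPositiveFrame (o.at_ q) (Fin.snoc (fun i => L (b i)) n)) ∧
  (Module.finrank ℝ (LinearMap.range L.toLinearMap) < d → n = 0)

/-- `u ∈ Imm_p(Q; N)`, with `du` the colocal weak derivative of `u`, `ν` the oriented unit normal
`ν_u` of `u` along `du`, and `dν` the colocal weak derivative of `ν_u`, regarded as a map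
`Q → TN`, `x ↦ (u x, ν x)`: the map `u` belongs to the homogeneous Sobolev space
`Ẇ^{1,p}(Q; N)`, its derivative has rank `d` almost everywhere, and `ν_u` belongs to
`Ẇ^{1,p}(Q; TN)`, where `TN` carries the Sasaki metric. -/
structure IsSobolevImmersion (p : ℝ) (o : ManifoldOrientation d N)
    (Q : Set (EuclideanSpace ℝ (Fin d))) (u : EuclideanSpace ℝ (Fin d) → N)
    (du : ∀ x, EuclideanSpace ℝ (Fin d) →L[ℝ] TangentSpace (𝓡 (d + 1)) (u x))
    (ν : ∀ x, TangentSpace (𝓡 (d + 1)) (u x))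
    (dν : ∀ x, EuclideanSpace ℝ (Fin d) →L[ℝ]
      TangentSpace (𝓡 (d + 1)).tangent (⟨u x, ν x⟩ : TangentBundle (𝓡 (d + 1)) N)) : Prop where
  deriv_map : IsColocalWeakDeriv (𝓡 (d + 1)) Q u du
  memLp_map : MemLp (fun x => derivNorm (du x)) (ENNReal.ofReal p)
    (volume.restrict Q)
  rank_eq : ∀ᵐ x ∂(volume.restrict Q), Module.finrank ℝ (LinearMap.range (du x).toLinearMap) = d
  normal : ∀ x ∈ Q, IsOrientedUnitNormal o (du x) (ν x)
  deriv_normal : IsColocalWeakDeriv (𝓡 (d + 1)).tangent Q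
    (fun x => (⟨u x, ν x⟩ : TangentBundle (𝓡 (d + 1)) N)) dν
  memLp_normal : MemLp (fun x => frobeniusNorm (sasakiNorm ⟨u x, ν x⟩) (dν x)) (ENNReal.ofReal p)
    (volume.restrict Q)

/-- The bending energy `E_b(u) = ∫_Q |K_TN ∘ d(ν_u)_x|^p dx`. -/
noncomputable def bendingEnergy (p : ℝ) (Q : Set (EuclideanSpace ℝ (Fin d)))
    (u : EuclideanSpace ℝ (Fin d) → N) (ν : ∀ x, TangentSpace (𝓡 (d + 1)) (u x))
    (dν : ∀ x, EuclideanSpace ℝ (Fin d) →L[ℝ]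
      TangentSpace (𝓡 (d + 1)).tangent (⟨u x, ν x⟩ : TangentBundle (𝓡 (d + 1)) N)) : ℝ≥0∞ :=
  ∫⁻ x in Q, ENNReal.ofReal
    (frobeniusNorm (fun ξ => ‖connector (⟨u x, ν x⟩ : TangentBundle (𝓡 (d + 1)) N) ξ‖) (dν x) ^ p)

/-! ## Almost isometric charts and their extensions -/

/-- The chart `φ` of the smooth structure of `N` is `ε`-isometric: in `φ(U)` the metric satisfies
`(1 + ε)⁻¹ e < h < (1 + ε) e` as quadratic forms, with `e` the Euclidean metric, and all Christoffel
symbols are bounded by `ε`. -/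
structure IsAlmostIsometricChart (ε : ℝ)
    (φ : OpenPartialHomeomorph N (EuclideanSpace ℝ (Fin (d + 1)))) : Prop where
  mem_atlas : φ ∈ IsManifold.maximalAtlas (𝓡 (d + 1)) ∞ N
  lower : ∀ y ∈ φ.target, ∀ v, v ≠ 0 → 1 / (1 + ε) * ‖v‖ ^ 2 < chartMetric φ y v v
  upper : ∀ y ∈ φ.target, ∀ v, v ≠ 0 → chartMetric φ y v v < (1 + ε) * ‖v‖ ^ 2
  christoffel_le : ∀ y ∈ φ.target, ∀ i j k, |christoffel φ y i j k| ≤ ε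

end Manifold

/-- A cut-off of the identity: `θ ∈ C_c^∞(ℝⁿ; ℝⁿ)`, `θ = Id` in `B(0, 1)` and `θ = 0` outside
`B(0, 2)`. -/
structure IsIdentityCutoff {n : ℕ} (θ : EuclideanSpace ℝ (Fin n) → EuclideanSpace ℝ (Fin n)) :
    Prop where
  contDiff : ContDiff ℝ ∞ θ
  hasCompactSupport : HasCompactSupport θ
  eq_self : ∀ y ∈ Metric.ball (0 : EuclideanSpace ℝ (Fin n)) 1, θ y = y
  eq_zero : ∀ y ∉ Metric.ball (0 : EuclideanSpace ℝ (Fin n)) 2, θ y = 0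

open Classical in
/-- The extension `φ^{(r)}` of the chart `(U, φ)` by `θ`: `φ^{(r)} = r θ(φ / r)` in `U` and
`φ^{(r)} = 0` in `N \ U`. -/
noncomputable def extendChart {n : ℕ} {N : Type u} [TopologicalSpace N]
    (θ : EuclideanSpace ℝ (Fin n) → EuclideanSpace ℝ (Fin n))
    (φ : OpenPartialHomeomorph N (EuclideanSpace ℝ (Fin n))) (r : ℝ) (q : N) :
    EuclideanSpace ℝ (Fin n) :=
  if q ∈ φ.source then r • θ (r⁻¹ • φ q) else 0

/-- The coordinate normal `ñ(x) = Dφ^{(r)}(u(x))(ν(x))`. -/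
noncomputable def coordNormal {d : ℕ} {N : Type u} [TopologicalSpace N]
    [ChartedSpace (EuclideanSpace ℝ (Fin (d + 1))) N]
    (θ : EuclideanSpace ℝ (Fin (d + 1)) → EuclideanSpace ℝ (Fin (d + 1)))
    (φ : OpenPartialHomeomorph N (EuclideanSpace ℝ (Fin (d + 1)))) (r : ℝ)
    (u : EuclideanSpace ℝ (Fin d) → N) (ν : ∀ x, TangentSpace (𝓡 (d + 1)) (u x))
    (x : EuclideanSpace ℝ (Fin d)) : EuclideanSpace ℝ (Fin (d + 1)) :=
  mfderiv (𝓡 (d + 1)) 𝓘(ℝ, EuclideanSpace ℝ (Fin (d + 1))) (extendChart θ φ r) (u x) (ν x)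

/-!
Off the boundary of the chart, `ñ` is the composition of `x ↦ (u x, ν x)` with the function on `TN`
given in the coordinates `(y, w)` of a chart by `Dθ(y / r) w`. As `|ν| ≤ 1`, this function can be
cut off in the fibre direction, and the definition of the colocal weak derivative then yields a
weak derivative of `ñ`. It has a horizontal and a vertical part: the second derivative of
`y ↦ r θ(y / r)` is `O(1 / r)` and vanishes on `B(0, r)`, which accounts for the integral over
`Q \ F`, while the derivative of the fibre coordinate is the sum of the connector and a term that is
linear in the Christoffel symbols and in `du`. For the chain rule the support of the function has to
be a compact subset of the chart domain, so it is applied to radii `s < r` and `s` tends to `r`.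
-/

local notation "𝔼[" n "]" => EuclideanSpace ℝ (Fin n)

/-! ## Weak derivatives and the Frobenius norm -/

section WeakDeriv

variable {d : ℕ} {F : Type*} [NormedAddCommGroup F] [NormedSpace ℝ F] {Q : Set 𝔼[d]}

lemma integrable_smul_of_tsupport_subset {f : 𝔼[d] → F} (hf : LocallyIntegrableOn f Q volume)
    {η : 𝔼[d] → ℝ} (hη : Continuous η) (hc : HasCompactSupport η) (hs : tsupport η ⊆ Q) :
    Integrable (fun x => η x • f x) volume := by
  have h : IntegrableOn (fun x => η x • f x) (tsupport η) volume :=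
    (hf.integrableOn_compact_subset hs hc).continuousOn_smul hη.continuousOn hc
  exact (integrableOn_iff_integrable_of_support_subset fun x hx =>
    subset_tsupport η fun h0 => hx (by simp [h0])).1 h

namespace HasWeakDeriv

variable {f f₁ f₂ : 𝔼[d] → F} {g g₁ g₂ : 𝔼[d] → 𝔼[d] →L[ℝ] F}

lemma congr_ae (h : HasWeakDeriv Q f₁ g₁) (hf : f₁ =ᵐ[volume.restrict Q] f₂)
    (hg : g₁ =ᵐ[volume.restrict Q] g₂) : HasWeakDeriv Q f₂ g₂ := by
  refine ⟨h.1.congr hf, h.2.1.congr hg, fun η hη hc hs v => ?_⟩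
  rw [← integral_congr_ae (hf.mono fun x hx => congrArg (fderiv ℝ η x v • ·) hx),
    h.2.2 η hη hc hs v, integral_congr_ae (hg.mono fun x hx => congrArg (fun L => η x • L v) hx)]

lemma congr (hQ : MeasurableSet Q) (h : HasWeakDeriv Q f₁ g₁) (hf : EqOn f₁ f₂ Q)
    (hg : EqOn g₁ g₂ Q) : HasWeakDeriv Q f₂ g₂ :=
  h.congr_ae (ae_restrict_of_forall_mem hQ hf) (ae_restrict_of_forall_mem hQ hg)

lemma integrableOn_fderiv_smul (h : HasWeakDeriv Q f g) {η : 𝔼[d] → ℝ} (hη : ContDiff ℝ ∞ η)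
    (hc : HasCompactSupport η) (hs : tsupport η ⊆ Q) (v : 𝔼[d]) :
    IntegrableOn (fun x => fderiv ℝ η x v • f x) Q :=
  (integrable_smul_of_tsupport_subset (η := fun x => fderiv ℝ η x v) h.1
    ((hη.continuous_fderiv (by simp)).clm_apply continuous_const) (hc.fderiv_apply ℝ v)
    ((tsupport_fderiv_apply_subset ℝ v).trans hs)).integrableOn

lemma integrableOn_smul_apply (h : HasWeakDeriv Q f g) {η : 𝔼[d] → ℝ} (hη : ContDiff ℝ ∞ η)
    (hc : HasCompactSupport η) (hs : tsupport η ⊆ Q) (v : 𝔼[d]) :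
    IntegrableOn (fun x => η x • g x v) Q :=
  ((ContinuousLinearMap.apply ℝ F v).integrable_comp
    (integrable_smul_of_tsupport_subset h.2.1 hη.continuous hc hs)).integrableOn

lemma zero : HasWeakDeriv Q (fun _ => (0 : F)) (fun _ => 0) :=
  ⟨locallyIntegrableOn_zero (ε'' := F), locallyIntegrableOn_zero (ε'' := 𝔼[d] →L[ℝ] F), by simp⟩

lemma add (h₁ : HasWeakDeriv Q f₁ g₁) (h₂ : HasWeakDeriv Q f₂ g₂) :
    HasWeakDeriv Q (fun x => f₁ x + f₂ x) (fun x => g₁ x + g₂ x) := by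
  refine ⟨h₁.1.add h₂.1, .add (ε'' := 𝔼[d] →L[ℝ] F) h₁.2.1 h₂.2.1, fun η hη hc hs v => ?_⟩
  simp only [smul_add, add_apply]
  rw [integral_add (h₁.integrableOn_fderiv_smul hη hc hs v)
      (h₂.integrableOn_fderiv_smul hη hc hs v),
    integral_add (h₁.integrableOn_smul_apply hη hc hs v) (h₂.integrableOn_smul_apply hη hc hs v),
    h₁.2.2 η hη hc hs v, h₂.2.2 η hη hc hs v, neg_add]

lemma sum {ι : Type*} (s : Finset ι) {f : ι → 𝔼[d] → F} {g : ι → 𝔼[d] → 𝔼[d] →L[ℝ] F}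
    (h : ∀ i ∈ s, HasWeakDeriv Q (f i) (g i)) :
    HasWeakDeriv Q (fun x => ∑ i ∈ s, f i x) (fun x => ∑ i ∈ s, g i x) := by
  classical
  induction s using Finset.induction_on with
  | empty => simp [zero]
  | insert a s ha ih =>
    simp only [Finset.sum_insert ha]
    exact (h a (Finset.mem_insert_self a s)).add
      (ih fun i hi => h i (Finset.mem_insert_of_mem hi))

lemma smul_const [CompleteSpace F] {f : 𝔼[d] → ℝ} {g : 𝔼[d] → 𝔼[d] →L[ℝ] ℝ}
    (h : HasWeakDeriv Q f g) (c : F) :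
    HasWeakDeriv Q (fun x => f x • c) (fun x => (g x).smulRight c) := by
  refine ⟨(ContinuousLinearMap.toSpanSingleton ℝ c).locallyIntegrableOn_comp h.1,
    ((ContinuousLinearMap.smulRightL ℝ 𝔼[d] F).flip c).locallyIntegrableOn_comp h.2.1,
    fun η hη hc hs v => ?_⟩
  simp only [ContinuousLinearMap.smulRight_apply, smul_smul]
  rw [integral_smul_const, integral_smul_const, ← neg_smul]
  exact congrArg (· • c) (h.2.2 η hη hc hs v)

end HasWeakDeriv

lemma hasWeakDeriv_of_forall_dual [FiniteDimensional ℝ F] {f : 𝔼[d] → F}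
    {g : 𝔼[d] → 𝔼[d] →L[ℝ] F}
    (h : ∀ l : F →L[ℝ] ℝ, HasWeakDeriv Q (fun x => l (f x)) (fun x => l.comp (g x))) :
    HasWeakDeriv Q f g := by
  have := FiniteDimensional.complete ℝ F
  let b := Module.finBasis ℝ F
  convert HasWeakDeriv.sum Finset.univ fun i _ =>
    (h (LinearMap.toContinuousLinearMap (b.coord i))).smul_const (b i) using 1
  · ext x
    exact (b.sum_repr (f x)).symm
  · ext x v
    simp [sum_apply]

namespace HasWeakDeriv

lemma ae_eq [CompleteSpace F] (hQ : IsOpen Q) {f : 𝔼[d] → F} {g g' : 𝔼[d] → 𝔼[d] →L[ℝ] F}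
    (h : HasWeakDeriv Q f g) (h' : HasWeakDeriv Q f g') : g =ᵐ[volume.restrict Q] g' := by
  suffices H : ∀ᵐ x, x ∈ Q → (g - g') x = 0 from
    ((ae_restrict_iff' hQ.measurableSet).2 H).mono fun x hx => sub_eq_zero.1 hx
  refine hQ.ae_eq_zero_of_integral_contDiff_smul_eq_zero (h.2.1.sub h'.2.1) fun η hη hc hs => ?_
  have apply_integral {k : 𝔼[d] → 𝔼[d] →L[ℝ] F} (hk : LocallyIntegrableOn k Q volume)
      (v : 𝔼[d]) : (∫ x, η x • k x) v = ∫ x in Q, η x • k x v := by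
    rw [ContinuousLinearMap.integral_apply
      (integrable_smul_of_tsupport_subset hk hη.continuous hc hs)]
    refine (setIntegral_eq_integral_of_forall_compl_eq_zero fun x hx => ?_).symm
    simp [image_eq_zero_of_notMem_tsupport fun hx' => hx (hs hx')]
  ext v
  rw [apply_integral (h.2.1.sub h'.2.1), zero_apply]
  simp only [Pi.sub_apply, sub_apply, smul_sub]
  rw [integral_sub (h.integrableOn_smul_apply hη hc hs v) (h'.integrableOn_smul_apply hη hc hs v),
    sub_eq_zero, ← neg_inj, ← h.2.2 η hη hc hs v, ← h'.2.2 η hη hc hs v]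

end HasWeakDeriv

lemma tendsto_setIntegral_smul_of_dominated {ρ : 𝔼[d] → ℝ} (hρ : Continuous ρ)
    (hc : HasCompactSupport ρ) {fs : ℕ → 𝔼[d] → F} {f : 𝔼[d] → F} {B : 𝔼[d] → ℝ}
    (hm : ∀ n, AEStronglyMeasurable (fs n) (volume.restrict Q)) (hB : IntegrableOn B Q)
    (hfB : ∀ n, ∀ᵐ x ∂volume.restrict Q, ‖fs n x‖ ≤ B x)
    (hf : ∀ᵐ x ∂volume.restrict Q, Filter.Tendsto (fs · x) Filter.atTop (𝓝 (f x))) :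
    Filter.Tendsto (fun n => ∫ x in Q, ρ x • fs n x) Filter.atTop (𝓝 (∫ x in Q, ρ x • f x)) := by
  obtain ⟨C, hC⟩ := hc.exists_bound_of_continuous hρ
  refine tendsto_integral_of_dominated_convergence (fun x => C * B x)
    (fun n => hρ.aestronglyMeasurable.smul (hm n)) (hB.const_mul C) (fun n => ?_)
    (hf.mono fun x hx => hx.const_smul _)
  filter_upwards [hfB n] with x hx
  rw [norm_smul]
  exact mul_le_mul (hC x) hx (norm_nonneg _) ((norm_nonneg _).trans (hC x))

lemma integrableOn_of_tendsto_of_dominated {G : Type*} [NormedAddCommGroup G] {fs : ℕ → 𝔼[d] → G}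
    {f : 𝔼[d] → G} {B : 𝔼[d] → ℝ}
    (hm : ∀ n, AEStronglyMeasurable (fs n) (volume.restrict Q)) (hB : IntegrableOn B Q)
    (hfB : ∀ n, ∀ᵐ x ∂volume.restrict Q, ‖fs n x‖ ≤ B x)
    (hf : ∀ᵐ x ∂volume.restrict Q, Filter.Tendsto (fs · x) Filter.atTop (𝓝 (f x))) :
    IntegrableOn f Q := by
  refine hB.mono' (aestronglyMeasurable_of_tendsto_ae _ hm hf) ?_
  filter_upwards [hf, ae_all_iff.2 hfB] with x h1 h2
  exact le_of_tendsto h1.norm (.of_forall h2)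

lemma HasWeakDeriv.of_tendsto {fs : ℕ → 𝔼[d] → F} {gs : ℕ → 𝔼[d] → 𝔼[d] →L[ℝ] F}
    {f : 𝔼[d] → F} {g : 𝔼[d] → 𝔼[d] →L[ℝ] F} (h : ∀ n, HasWeakDeriv Q (fs n) (gs n))
    (hfm : ∀ n, AEStronglyMeasurable (fs n) (volume.restrict Q))
    (hgm : ∀ n, AEStronglyMeasurable (gs n) (volume.restrict Q))
    {B b : 𝔼[d] → ℝ} (hB : IntegrableOn B Q) (hb : IntegrableOn b Q)
    (hfB : ∀ n, ∀ᵐ x ∂volume.restrict Q, ‖fs n x‖ ≤ B x)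
    (hgb : ∀ n, ∀ᵐ x ∂volume.restrict Q, ‖gs n x‖ ≤ b x)
    (hf : ∀ᵐ x ∂volume.restrict Q, Filter.Tendsto (fs · x) Filter.atTop (𝓝 (f x)))
    (hg : ∀ᵐ x ∂volume.restrict Q, Filter.Tendsto (gs · x) Filter.atTop (𝓝 (g x))) :
    HasWeakDeriv Q f g := by
  refine ⟨(integrableOn_of_tendsto_of_dominated hfm hB hfB hf).locallyIntegrableOn,
    (integrableOn_of_tendsto_of_dominated hgm hb hgb hg).locallyIntegrableOn,
    fun η hη hc hs v => ?_⟩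
  have lim_f := tendsto_setIntegral_smul_of_dominated
    ((hη.continuous_fderiv (by simp)).clm_apply continuous_const) (hc.fderiv_apply ℝ v)
    hfm hB hfB hf
  have lim_g := tendsto_setIntegral_smul_of_dominated hη.continuous hc
    (fs := fun n x => gs n x v) (f := fun x => g x v)
    (fun n => (ContinuousLinearMap.apply ℝ F v).continuous.comp_aestronglyMeasurable (hgm n))
    (hb.mul_const ‖v‖)
    (fun n => (hgb n).mono fun x hx => ((gs n x).le_opNorm v).trans (by gcongr))
    (hg.mono fun x hx => ((ContinuousLinearMap.apply ℝ F v).continuous.tendsto _).comp hx)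
  refine tendsto_nhds_unique lim_f ?_
  simp only [fun n => (h n).2.2 η hη hc hs v]
  exact lim_g.neg

lemma IsOpenCube.isOpen (h : IsOpenCube Q) : IsOpen Q := by
  obtain ⟨b, c, l, -, rfl⟩ := h
  rw [Set.ofPred_forall]
  exact isOpen_iInter_of_finite fun i => isOpen_lt (by fun_prop) continuous_const

lemma IsOpenCube.isBounded (h : IsOpenCube Q) : Bornology.IsBounded Q := by
  obtain ⟨b, c, l, -, rfl⟩ := h
  refine (Metric.isBounded_closedBall (x := c) (r := √(d * (l / 2) ^ 2))).subset fun x hx => ?_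
  rw [mem_closedBall_iff_norm]
  refine Real.le_sqrt_of_sq_le ?_
  rw [← b.sum_sq_inner_right]
  have coord_le : ∀ i ∈ Finset.univ, inner ℝ (b i) (x - c) ^ 2 ≤ (l / 2) ^ 2 := fun i _ => by
    rw [← sq_abs]
    exact pow_le_pow_left₀ (abs_nonneg _) (hx i).le 2
  simpa using Finset.sum_le_card_nsmul _ _ _ coord_le

end WeakDeriv

section Frobenius

variable {d : ℕ}

lemma frobeniusNorm_nonneg {W : Type*} (nrm : W → ℝ) (L : 𝔼[d] → W) : 0 ≤ frobeniusNorm nrm L :=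
  Real.sqrt_nonneg _

lemma frobeniusNorm_eq_norm {W : Type*} (nrm : W → ℝ) (L : 𝔼[d] → W) :
    frobeniusNorm nrm L = ‖WithLp.toLp 2 fun i => nrm (L (EuclideanSpace.single i 1))‖ := by
  simp [frobeniusNorm, EuclideanSpace.norm_eq]

lemma frobeniusNorm_le_of_forall {W₁ W₂ W₃ : Type*} {n₁ : W₁ → ℝ} {n₂ : W₂ → ℝ} {n₃ : W₃ → ℝ}
    {L₁ : 𝔼[d] → W₁} {L₂ : 𝔼[d] → W₂} {L₃ : 𝔼[d] → W₃} {a b : ℝ} (ha : 0 ≤ a) (hb : 0 ≤ b)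
    (h₁ : ∀ w, 0 ≤ n₁ w) (h : ∀ v, n₁ (L₁ v) ≤ a * n₂ (L₂ v) + b * n₃ (L₃ v)) :
    frobeniusNorm n₁ L₁ ≤ a * frobeniusNorm n₂ L₂ + b * frobeniusNorm n₃ L₃ := by
  rw [frobeniusNorm_eq_norm n₂, frobeniusNorm_eq_norm n₃]
  set x₂ : 𝔼[d] := WithLp.toLp 2 fun i => n₂ (L₂ (EuclideanSpace.single i 1))
  set x₃ : 𝔼[d] := WithLp.toLp 2 fun i => n₃ (L₃ (EuclideanSpace.single i 1))
  calc frobeniusNorm n₁ L₁ ≤ ‖a • x₂ + b • x₃‖ := by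
        rw [EuclideanSpace.norm_eq, frobeniusNorm]
        refine Real.sqrt_le_sqrt (Finset.sum_le_sum fun i _ => ?_)
        rw [Real.norm_eq_abs, sq_abs]
        exact pow_le_pow_left₀ (h₁ _) (h _) 2
    _ ≤ ‖a • x₂‖ + ‖b • x₃‖ := norm_add_le _ _
    _ = a * ‖x₂‖ + b * ‖x₃‖ := by rw [norm_smul_of_nonneg ha, norm_smul_of_nonneg hb]

lemma opNorm_le_frobeniusNorm {F : Type*} [NormedAddCommGroup F] [NormedSpace ℝ F]
    (L : 𝔼[d] →L[ℝ] F) : ‖L‖ ≤ frobeniusNorm (fun t : F => ‖t‖) L := by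
  refine L.opNorm_le_bound (frobeniusNorm_nonneg _ _) fun v => ?_
  calc ‖L v‖ = ‖∑ i, v i • L (EuclideanSpace.single i 1)‖ := by
        conv_lhs => rw [← (EuclideanSpace.basisFun (Fin d) ℝ).sum_repr v]
        simp
    _ ≤ ∑ i, |v i| * ‖L (EuclideanSpace.single i 1)‖ :=
        (norm_sum_le _ _).trans_eq (by simp [norm_smul])
    _ ≤ √(∑ i, |v i| ^ 2) * √(∑ i, ‖L (EuclideanSpace.single i 1)‖ ^ 2) :=
        Real.sum_mul_le_sqrt_mul_sqrt _ _ _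
    _ = frobeniusNorm (fun t : F => ‖t‖) L * ‖v‖ := by
        rw [mul_comm, EuclideanSpace.norm_eq]
        rfl

end Frobenius

/-! ## Charts of the tangent bundle -/

section ChartExtension

variable {X V F : Type*} [TopologicalSpace X] [TopologicalSpace V] {Φ : OpenPartialHomeomorph X V}

/-- The function `G ∘ Φ` on the domain of the chart `Φ`, extended by zero. -/
noncomputable def chartExtension [Zero F] (Φ : OpenPartialHomeomorph X V) (G : V → F) : X → F :=
  Φ.source.indicator (G ∘ Φ)

section Support

variable [Zero F] {G : V → F}

lemma chartExtension_apply {q : X} (hq : q ∈ Φ.source) : chartExtension Φ G q = G (Φ q) :=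
  indicator_of_mem hq _

lemma chartExtension_eventuallyEq {q : X} (hq : q ∈ Φ.source) :
    chartExtension Φ G =ᶠ[𝓝 q] G ∘ Φ :=
  Filter.mem_of_superset (Φ.open_source.mem_nhds hq) fun _ => chartExtension_apply

lemma tendsto_chartExtension [TopologicalSpace F] {ι : Type*} {l : Filter ι} {H : ι → V → F}
    (h : ∀ y, Filter.Tendsto (fun i => H i y) l (𝓝 (G y))) (q : X) :
    Filter.Tendsto (fun i => chartExtension Φ (H i) q) l (𝓝 (chartExtension Φ G q)) := by
  by_cases hq : q ∈ Φ.source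
  · simpa only [chartExtension_apply hq] using h (Φ q)
  · simpa only [chartExtension, indicator_of_notMem hq] using tendsto_const_nhds

lemma isCompact_symm_image {K : Set V} (hK : IsCompact K) (hs : K ⊆ Φ.target) :
    IsCompact (Φ.symm '' K) :=
  hK.image_of_continuousOn (Φ.symm.continuousOn.mono hs)

lemma tsupport_chartExtension_subset [T2Space X] (hc : HasCompactSupport G)
    (hs : tsupport G ⊆ Φ.target) : tsupport (chartExtension Φ G) ⊆ Φ.symm '' tsupport G := by
  refine closure_minimal (fun q hq => ?_) (isCompact_symm_image hc hs).isClosed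
  obtain ⟨hqs, hGq⟩ := indicator_apply_ne_zero.1 hq
  exact ⟨Φ q, subset_tsupport G hGq, Φ.left_inv hqs⟩

lemma hasCompactSupport_chartExtension [T2Space X] (hc : HasCompactSupport G)
    (hs : tsupport G ⊆ Φ.target) : HasCompactSupport (chartExtension Φ G) :=
  (isCompact_symm_image hc hs).of_isClosed_subset (isClosed_tsupport _)
    (tsupport_chartExtension_subset hc hs)

end Support

end ChartExtension

section ChartExtensionSmooth

variable {B H X V F : Type*} [NormedAddCommGroup B] [NormedSpace ℝ B] [TopologicalSpace H]
  {I : ModelWithCorners ℝ B H} [TopologicalSpace X] [ChartedSpace H X]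
  [NormedAddCommGroup V] [NormedSpace ℝ V] [NormedAddCommGroup F] [NormedSpace ℝ F]
  {Φ : OpenPartialHomeomorph X V} {G : V → F}

lemma contMDiff_chartExtension [T2Space X] (hΦ : ContMDiffOn I 𝓘(ℝ, V) 1 Φ Φ.source)
    (hG : ContDiff ℝ 1 G) (hc : HasCompactSupport G) (hs : tsupport G ⊆ Φ.target) :
    ContMDiff I 𝓘(ℝ, F) 1 (chartExtension Φ G) := by
  refine contMDiff_of_tsupport fun q hq => ?_
  obtain ⟨y, hy, rfl⟩ := tsupport_chartExtension_subset hc hs hq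
  have hy' := Φ.map_target (hs hy)
  exact (hG.contMDiff.contMDiffAt.comp _
    (hΦ.contMDiffAt (Φ.open_source.mem_nhds hy'))).congr_of_eventuallyEq
      (chartExtension_eventuallyEq hy')

lemma mvfderiv_chartExtension {q : X} {D : TangentSpace I q →L[ℝ] V} (hq : q ∈ Φ.source)
    (hΦ : HasMFDerivAt I 𝓘(ℝ, V) Φ q D) (hG : DifferentiableAt ℝ G (Φ q)) :
    mvfderiv I (chartExtension Φ G) q = (fderiv ℝ G (Φ q)).comp D :=
  ((chartExtension_eventuallyEq hq).mfderiv_eq.trans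
    (hG.hasFDerivAt.hasMFDerivAt.comp q hΦ).mfderiv :)

end ChartExtensionSmooth

section Charts

variable {E : Type*} [NormedAddCommGroup E] [NormedSpace ℝ E]
  {N : Type*} [TopologicalSpace N] [ChartedSpace E N]
  {φ ψ : OpenPartialHomeomorph N E}

/-- The differential `dφ_q`, as a linear map into the model space. -/
noncomputable def chartDeriv (φ : OpenPartialHomeomorph N E) (q : N) :
    TangentSpace 𝓘(ℝ, E) q →L[ℝ] E :=
  mfderiv 𝓘(ℝ, E) 𝓘(ℝ, E) φ q

/-- The differential `d(φ⁻¹)_y`, as a linear map from the model space. -/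
noncomputable def chartSymmDeriv (φ : OpenPartialHomeomorph N E) (y : E) :
    E →L[ℝ] TangentSpace 𝓘(ℝ, E) (φ.symm y) :=
  mfderiv 𝓘(ℝ, E) 𝓘(ℝ, E) φ.symm y

lemma mdifferentiable_of_mem_maximalAtlas (hφ : φ ∈ IsManifold.maximalAtlas 𝓘(ℝ, E) ∞ N) :
    φ.MDifferentiable 𝓘(ℝ, E) 𝓘(ℝ, E) :=
  ⟨(contMDiffOn_of_mem_maximalAtlas hφ).mdifferentiableOn (by simp),
    (contMDiffOn_symm_of_mem_maximalAtlas hφ).mdifferentiableOn (by simp)⟩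

lemma hasMFDerivAt_chartDeriv (hφ : φ ∈ IsManifold.maximalAtlas 𝓘(ℝ, E) ∞ N) {q : N}
    (hq : q ∈ φ.source) : HasMFDerivAt 𝓘(ℝ, E) 𝓘(ℝ, E) φ q (chartDeriv φ q) :=
  ((mdifferentiable_of_mem_maximalAtlas hφ).mdifferentiableAt hq).hasMFDerivAt

lemma chartSymmDeriv_chartDeriv (hφ : φ ∈ IsManifold.maximalAtlas 𝓘(ℝ, E) ∞ N) {q : N}
    (hq : q ∈ φ.source) (v : TangentSpace 𝓘(ℝ, E) q) :
    chartSymmDeriv φ (φ q) (chartDeriv φ q v) = v :=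
  congrArg (fun L => L v) ((mdifferentiable_of_mem_maximalAtlas hφ).symm_comp_deriv hq)

lemma chartDeriv_chartSymmDeriv (hφ : φ ∈ IsManifold.maximalAtlas 𝓘(ℝ, E) ∞ N) {y : E}
    (hy : y ∈ φ.target) (v : E) : chartDeriv φ (φ.symm y) (chartSymmDeriv φ y v) = v :=
  congrArg (fun L => L v) ((mdifferentiable_of_mem_maximalAtlas hφ).comp_symm_deriv hy)

/-- The fibre coordinates `(q, v) ↦ dφ_q v` on the tangent bundle. -/
noncomputable def fiberCoord (φ : OpenPartialHomeomorph N E) (e : TangentBundle 𝓘(ℝ, E) N) : E :=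
  chartDeriv φ e.proj e.snd

lemma chartDeriv_chartSymmDeriv_of_mem_source (hφ : φ ∈ IsManifold.maximalAtlas 𝓘(ℝ, E) ∞ N)
    {q : N} (hq : q ∈ φ.source) (v : E) : chartDeriv φ q (chartSymmDeriv φ (φ q) v) = v := by
  have deriv_eq := chartDeriv_chartSymmDeriv hφ (φ.map_source hq) v
  rwa [φ.left_inv hq] at deriv_eq

section Transition

variable (hφ : φ ∈ IsManifold.maximalAtlas 𝓘(ℝ, E) ∞ N)
  (hψ : ψ ∈ IsManifold.maximalAtlas 𝓘(ℝ, E) ∞ N)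

include hφ hψ

lemma contDiffAt_transition {q : N} (hq : q ∈ φ.source) (hq' : q ∈ ψ.source) :
    ContDiffAt ℝ ∞ (φ ∘ ψ.symm) (ψ q) := by
  have smooth_φ : ContMDiffAt 𝓘(ℝ, E) 𝓘(ℝ, E) ∞ φ (ψ.symm (ψ q)) := by
    rw [ψ.left_inv hq']
    exact contMDiffAt_of_mem_maximalAtlas hφ hq
  exact (smooth_φ.comp _
    (contMDiffAt_symm_of_mem_maximalAtlas hψ (ψ.map_source hq'))).contDiffAt

lemma chartDeriv_eq_fderiv_transition {q : N} (hq : q ∈ φ.source) (hq' : q ∈ ψ.source)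
    (v : TangentSpace 𝓘(ℝ, E) q) :
    chartDeriv φ q v = fderiv ℝ (φ ∘ ψ.symm) (ψ q) (chartDeriv ψ q v) := by
  have φ_eq : (φ : N → E) =ᶠ[𝓝 q] (φ ∘ ψ.symm) ∘ ψ := by
    filter_upwards [ψ.open_source.mem_nhds hq'] with q hq
    simp only [Function.comp, ψ.left_inv hq]
  have deriv_comp := ((contDiffAt_transition hφ hψ hq hq').differentiableAt
    (by simp)).hasFDerivAt.hasMFDerivAt.comp q (hasMFDerivAt_chartDeriv hψ hq')
  rw [chartDeriv, φ_eq.mfderiv_eq, deriv_comp.mfderiv]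
  rfl

lemma fiberCoord_change {e : TangentBundle 𝓘(ℝ, E) N} (he : e.proj ∈ φ.source)
    (he' : e.proj ∈ ψ.source) :
    fiberCoord φ e = fderiv ℝ (φ ∘ ψ.symm) (ψ e.proj) (fiberCoord ψ e) :=
  chartDeriv_eq_fderiv_transition hφ hψ he he' _

end Transition

variable [IsManifold 𝓘(ℝ, E) ∞ N]

lemma contMDiffOn_fiberCoord (hφ : φ ∈ IsManifold.maximalAtlas 𝓘(ℝ, E) ∞ N) :
    ContMDiffOn 𝓘(ℝ, E).tangent 𝓘(ℝ, E) ∞ (fiberCoord φ) (TotalSpace.proj ⁻¹' φ.source) := by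
  have smooth_tangentMap := (contMDiffOn_of_mem_maximalAtlas hφ).contMDiffOn_tangentMapWithin
    (m := ∞) (by simp) φ.open_source.uniqueMDiffOn
  refine ((contMDiff_snd_tangentBundle_modelSpace E 𝓘(ℝ, E) (n := ∞)).comp_contMDiffOn
    smooth_tangentMap).congr fun e he => ?_
  simp only [fiberCoord, chartDeriv, Function.comp, tangentMapWithin]
  rw [mfderivWithin_of_isOpen φ.open_source he]
  rfl

lemma contMDiffOn_bundleCoord (hφ : φ ∈ IsManifold.maximalAtlas 𝓘(ℝ, E) ∞ N) :
    ContMDiffOn 𝓘(ℝ, E).tangent 𝓘(ℝ, E × E) ∞ (fun e => (φ e.proj, fiberCoord φ e))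
      (TotalSpace.proj ⁻¹' φ.source) :=
  ((contMDiffOn_of_mem_maximalAtlas hφ).comp
    (contMDiff_proj (TangentSpace 𝓘(ℝ, E) : N → Type _)).contMDiffOn fun _ he => he).prodMk_space
      (contMDiffOn_fiberCoord hφ)

lemma continuousOn_bundleCoord_symm (hφ : φ ∈ IsManifold.maximalAtlas 𝓘(ℝ, E) ∞ N) :
    ContinuousOn
      (fun z : E × E => (⟨φ.symm z.1, chartSymmDeriv φ z.1 z.2⟩ : TangentBundle 𝓘(ℝ, E) N))
      (φ.target ×ˢ univ) := by
  have cont_tangentMap := (contMDiffOn_symm_of_mem_maximalAtlas hφ).continuousOn_tangentMapWithin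
    (by simp) φ.open_target.uniqueMDiffOn
  have cont_symm : Continuous (tangentBundleModelSpaceHomeomorph 𝓘(ℝ, E)).symm :=
    Homeomorph.continuous _
  refine (cont_tangentMap.comp (cont_symm.continuousOn (s := φ.target ×ˢ univ))
    fun z hz => hz.1).congr fun z hz => ?_
  simp only [Function.comp, tangentMapWithin, chartSymmDeriv,
    tangentBundleModelSpaceHomeomorph_coe_symm, TotalSpace.toProd, Equiv.coe_fn_symm_mk]
  rw [mfderivWithin_of_isOpen φ.open_target hz.1]
  rfl

/-- The chart `(q, v) ↦ (φ(q), dφ_q v)` of the tangent bundle induced by a chart `φ`. Its target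
`φ.target × E` lies in the product `E × E` rather than in the model of `TN`. -/
@[simps]
noncomputable def bundleChart (φ : OpenPartialHomeomorph N E)
    (hφ : φ ∈ IsManifold.maximalAtlas 𝓘(ℝ, E) ∞ N) :
    OpenPartialHomeomorph (TangentBundle 𝓘(ℝ, E) N) (E × E) where
  toFun e := (φ e.proj, fiberCoord φ e)
  invFun z := ⟨φ.symm z.1, chartSymmDeriv φ z.1 z.2⟩
  source := TotalSpace.proj ⁻¹' φ.source
  target := φ.target ×ˢ univ
  map_source' _ he := ⟨φ.map_source he, mem_univ _⟩
  map_target' _ hz := φ.map_target hz.1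
  left_inv' := by
    rintro ⟨q, v⟩ hq
    have mk_eq (q' : N) (v' : TangentSpace 𝓘(ℝ, E) q') (hq' : q' = q) (hv' : v' = v) :
        (⟨q', v'⟩ : TangentBundle 𝓘(ℝ, E) N) = ⟨q, v⟩ := by
      subst hq' hv'
      rfl
    exact mk_eq _ _ (φ.left_inv hq) (chartSymmDeriv_chartDeriv hφ hq v)
  right_inv' z hz := Prod.ext (φ.right_inv hz.1) (chartDeriv_chartSymmDeriv hφ hz.1 z.2)
  open_source := φ.open_source.preimage
    (FiberBundle.continuous_proj E (TangentSpace 𝓘(ℝ, E) : N → Type _))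
  open_target := φ.open_target.prod isOpen_univ
  continuousOn_toFun := (contMDiffOn_bundleCoord hφ).continuousOn
  continuousOn_invFun := continuousOn_bundleCoord_symm hφ

/-- The horizontal coordinates `dφ(dπ ξ)` of `ξ ∈ TTN`. -/
noncomputable def baseVelocity (φ : OpenPartialHomeomorph N E) (e : TangentBundle 𝓘(ℝ, E) N) :
    TangentSpace 𝓘(ℝ, E).tangent e →L[ℝ] E :=
  (chartDeriv φ e.proj).comp
    (mfderiv 𝓘(ℝ, E).tangent 𝓘(ℝ, E) (fun e' : TangentBundle 𝓘(ℝ, E) N => e'.proj) e)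

/-- The vertical coordinates of `ξ ∈ TTN`: the derivative along `ξ` of the fibre coordinates. -/
noncomputable def fiberVelocity (φ : OpenPartialHomeomorph N E) (e : TangentBundle 𝓘(ℝ, E) N) :
    TangentSpace 𝓘(ℝ, E).tangent e →L[ℝ] E :=
  mfderiv 𝓘(ℝ, E).tangent 𝓘(ℝ, E) (fiberCoord φ) e

lemma hasMFDerivAt_bundleChart (hφ : φ ∈ IsManifold.maximalAtlas 𝓘(ℝ, E) ∞ N)
    {e : TangentBundle 𝓘(ℝ, E) N} (he : e.proj ∈ φ.source) :
    HasMFDerivAt 𝓘(ℝ, E).tangent 𝓘(ℝ, E × E) (bundleChart φ hφ) e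
      ((baseVelocity φ e).prod (fiberVelocity φ e)) := by
  have deriv_proj := ((contMDiff_proj (n := ∞) (IB := 𝓘(ℝ, E))
    (TangentSpace 𝓘(ℝ, E) : N → Type _)).mdifferentiableAt (x := e) (by simp)).hasMFDerivAt
  have deriv_base := (hasMFDerivAt_chartDeriv hφ he).comp e deriv_proj
  have deriv_fiber := (((contMDiffOn_fiberCoord hφ).contMDiffAt
    ((bundleChart φ hφ).open_source.mem_nhds he)).mdifferentiableAt (by simp)).hasMFDerivAt
  exact ⟨deriv_base.1.prodMk deriv_fiber.1, deriv_base.2.prodMk deriv_fiber.2⟩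

section Transition

variable (hφ : φ ∈ IsManifold.maximalAtlas 𝓘(ℝ, E) ∞ N)
  (hψ : ψ ∈ IsManifold.maximalAtlas 𝓘(ℝ, E) ∞ N)

include hφ hψ

variable {e : TangentBundle 𝓘(ℝ, E) N} (he : e.proj ∈ φ.source) (he' : e.proj ∈ ψ.source)

include he he'

lemma baseVelocity_change (ξ : TangentSpace 𝓘(ℝ, E).tangent e) :
    baseVelocity φ e ξ = fderiv ℝ (φ ∘ ψ.symm) (ψ e.proj) (baseVelocity ψ e ξ) :=
  chartDeriv_eq_fderiv_transition hφ hψ he he' _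

lemma fiberVelocity_change (ξ : TangentSpace 𝓘(ℝ, E).tangent e) :
    fiberVelocity φ e ξ =
      fderiv ℝ (fderiv ℝ (φ ∘ ψ.symm)) (ψ e.proj) (baseVelocity ψ e ξ) (fiberCoord ψ e)
        + fderiv ℝ (φ ∘ ψ.symm) (ψ e.proj) (fiberVelocity ψ e ξ) := by
  set τ := φ ∘ ψ.symm
  have fiberCoord_eq :
      fiberCoord φ =ᶠ[𝓝 e] (fun z : E × E => fderiv ℝ τ z.1 z.2) ∘ bundleChart ψ hψ := by
    filter_upwards [(bundleChart φ hφ).open_source.mem_nhds he,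
      (bundleChart ψ hψ).open_source.mem_nhds he'] with e he he'
    exact fiberCoord_change hφ hψ he he'
  have diff_fderiv : DifferentiableAt ℝ (fderiv ℝ τ) (ψ e.proj) :=
    ((contDiffAt_transition hφ hψ he he').fderiv_right (m := 1) (by norm_cast)).differentiableAt
      one_ne_zero
  have deriv_eval : HasFDerivAt (fun z : E × E => fderiv ℝ τ z.1 z.2) _ (bundleChart ψ hψ e) :=
    (HasFDerivAt.comp (bundleChart ψ hψ e) (g := fderiv ℝ τ) (f := Prod.fst)
      diff_fderiv.hasFDerivAt hasFDerivAt_fst).clm_apply hasFDerivAt_snd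
  have deriv_comp := deriv_eval.hasMFDerivAt.comp e (hasMFDerivAt_bundleChart hψ he')
  rw [fiberVelocity, fiberCoord_eq.mfderiv_eq, deriv_comp.mfderiv, add_comm]
  rfl

end Transition

end Charts

lemma t2Space_totalSpace {B F : Type*} [TopologicalSpace B] [TopologicalSpace F] [T2Space B]
    [T2Space F] (E : B → Type*) [TopologicalSpace (TotalSpace F E)]
    [∀ b, TopologicalSpace (E b)] [FiberBundle F E] : T2Space (TotalSpace F E) := by
  refine ⟨fun e e' hne => ?_⟩
  by_cases hp : e.proj = e'.proj
  · let t := trivializationAt F E e.proj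
    have he : e ∈ t.source := FiberBundle.mem_trivializationAt_proj_source
    have he' : e' ∈ t.source := by
      rw [t.mem_source, ← hp]
      exact FiberBundle.mem_baseSet_trivializationAt' _
    have : T2Space t.source := t.toHomeomorphSourceTarget.symm.t2Space
    exact separated_by_isOpenEmbedding t.open_source.isOpenEmbedding_subtypeVal
      (x := ⟨e, he⟩) (y := ⟨e', he'⟩) fun h => hne (congrArg Subtype.val h)
  · exact separated_by_continuous (FiberBundle.continuous_proj F E) hp

/-! ## Christoffel symbols and the connector -/

section Euclidean

variable {n : ℕ} {F : Type*} [NormedAddCommGroup F] [NormedSpace ℝ F]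

lemma clm_ext_single {L L' : 𝔼[n] →L[ℝ] F}
    (h : ∀ i, L (EuclideanSpace.single i 1) = L' (EuclideanSpace.single i 1)) : L = L' :=
  ContinuousLinearMap.coe_injective <|
    (EuclideanSpace.basisFun (Fin n) ℝ).toBasis.ext fun i => by simpa using h i

lemma sum_smul_single (v : 𝔼[n]) : ∑ i, v i • EuclideanSpace.single i (1 : ℝ) = v := by
  simpa using (EuclideanSpace.basisFun (Fin n) ℝ).sum_repr v

lemma bilinear_eq_sum (B : 𝔼[n] →L[ℝ] 𝔼[n] →L[ℝ] F) (v w : 𝔼[n]) :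
    B v w = ∑ i, ∑ j, (w j * v i) •
      B (EuclideanSpace.single i 1) (EuclideanSpace.single j 1) := by
  conv_lhs => rw [← sum_smul_single v, ← sum_smul_single w]
  simp only [map_sum, map_smul, sum_apply, smul_apply, Finset.smul_sum, smul_smul]
  exact Finset.sum_comm

end Euclidean

section BilinearForms

variable {E : Type*} [NormedAddCommGroup E] [NormedSpace ℝ E]

/-- The right-hand side of the Koszul formula
`2 h(∇_Y w, Z) = ∂_Y h(w, Z) + ∂_w h(Y, Z) - ∂_Z h(Y, w)` for constant vector fields, where `D`
stands for the derivative of `h`. -/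
noncomputable def koszulForm (D : E →L[ℝ] E →L[ℝ] E →L[ℝ] ℝ) (Z : E) : E →L[ℝ] E →L[ℝ] ℝ :=
  let DZ := (ContinuousLinearMap.compL ℝ E (E →L[ℝ] ℝ) ℝ (ContinuousLinearMap.apply ℝ ℝ Z)).comp D
  DZ + DZ.flip - D Z

lemma koszulForm_apply (D : E →L[ℝ] E →L[ℝ] E →L[ℝ] ℝ) (Y w Z : E) :
    koszulForm D Z Y w = D Y w Z + D w Y Z - D Z Y w := rfl

lemma fderiv_pullback_form {A B : E → E →L[ℝ] E →L[ℝ] ℝ} {τ : E → E} {y : E}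
    (hτ : ContDiffAt ℝ 2 τ y)
    (hB : DifferentiableAt ℝ B (τ y)) (hA : DifferentiableAt ℝ A y)
    (h : ∀ a b, (fun z => A z a b) =ᶠ[𝓝 y] fun z => B (τ z) (fderiv ℝ τ z a) (fderiv ℝ τ z b))
    (v a b : E) :
    fderiv ℝ A y v a b = fderiv ℝ B (τ y) (fderiv ℝ τ y v) (fderiv ℝ τ y a) (fderiv ℝ τ y b)
      + B (τ y) (fderiv ℝ (fderiv ℝ τ) y v a) (fderiv ℝ τ y b)
      + B (τ y) (fderiv ℝ τ y a) (fderiv ℝ (fderiv ℝ τ) y v b) := by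
  have deriv_τ : HasFDerivAt τ (fderiv ℝ τ y) y :=
    (hτ.differentiableAt two_ne_zero).hasFDerivAt
  have deriv_fderiv : HasFDerivAt (fderiv ℝ τ) (fderiv ℝ (fderiv ℝ τ) y) y :=
    ((hτ.fderiv_right (m := 1) (by norm_cast)).differentiableAt one_ne_zero).hasFDerivAt
  have deriv_pullback (c : E) : HasFDerivAt (fun z => fderiv ℝ τ z c) _ y :=
    deriv_fderiv.clm_apply (hasFDerivAt_const c y)
  have deriv_Bτ : HasFDerivAt (fun z => B (τ z)) _ y :=
    HasFDerivAt.comp (g := B) (f := τ) y hB.hasFDerivAt deriv_τ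
  have deriv_left : HasFDerivAt (fun z => A z a b) _ y :=
    (hA.hasFDerivAt.clm_apply (hasFDerivAt_const a y)).clm_apply (hasFDerivAt_const b y)
  have deriv_right : HasFDerivAt (fun z => B (τ z) (fderiv ℝ τ z a) (fderiv ℝ τ z b)) _ y :=
    (deriv_Bτ.clm_apply (deriv_pullback a)).clm_apply (deriv_pullback b)
  have eq_deriv := congrArg (fun L => L v)
    ((deriv_left.congr_of_eventuallyEq (h a b).symm).unique deriv_right)
  simp only [ContinuousLinearMap.comp_zero, zero_add, ContinuousLinearMap.flip_apply,
    ContinuousLinearMap.flip_add, add_apply, ContinuousLinearMap.comp_apply] at eq_deriv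
  rw [eq_deriv]
  ring

end BilinearForms

section Metric

variable {d : ℕ} {N : Type u} [TopologicalSpace N] [ChartedSpace 𝔼[d + 1] N]
  [RiemannianBundle (fun q : N => TangentSpace (𝓡 (d + 1)) q)]
  {φ ψ : OpenPartialHomeomorph N 𝔼[d + 1]}

/-- The metric pushed forward by the chart `φ`, as a field of continuous bilinear forms. -/
noncomputable def chartForm (φ : OpenPartialHomeomorph N 𝔼[d + 1]) (y : 𝔼[d + 1]) :
    𝔼[d + 1] →L[ℝ] 𝔼[d + 1] →L[ℝ] ℝ :=
  (innerSL ℝ (E := TangentSpace (𝓡 (d + 1)) (φ.symm y))).bilinearComp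
    (chartSymmDeriv φ y) (chartSymmDeriv φ y)

lemma chartForm_apply (y v w : 𝔼[d + 1]) : chartForm φ y v w = chartMetric φ y v w := rfl

lemma chartForm_comm (y v w : 𝔼[d + 1]) : chartForm φ y v w = chartForm φ y w v :=
  (real_inner_comm (F := TangentSpace (𝓡 (d + 1)) (φ.symm y)) _ _).symm

lemma chartForm_toLp_single (y : 𝔼[d + 1]) (a : Fin (d + 1) → ℝ) (m : Fin (d + 1)) :
    chartForm φ y (WithLp.toLp 2 a) (EuclideanSpace.single m 1) = (chartGram φ y).mulVec a m := by
  rw [chartForm_comm, ← sum_smul_single (WithLp.toLp 2 a)]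
  simp only [map_sum, map_smul, Matrix.mulVec, dotProduct, chartGram, Matrix.of_apply,
    chartForm_apply, smul_eq_mul, mul_comm]

/-- The vector `(Γ_{ij}^k)_k` of Christoffel symbols. -/
noncomputable def christoffelVector (φ : OpenPartialHomeomorph N 𝔼[d + 1]) (y : 𝔼[d + 1])
    (i j : Fin (d + 1)) : 𝔼[d + 1] :=
  WithLp.toLp 2 (christoffel φ y i j)

/-- The bilinear map `Γ(Y, w)^k = ∑ Γ_{ij}^k Y_i w_j` given by the Christoffel symbols. -/
noncomputable def christoffelForm (φ : OpenPartialHomeomorph N 𝔼[d + 1]) (y Y w : 𝔼[d + 1]) :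
    𝔼[d + 1] :=
  ∑ i, ∑ j, (w j * Y i) • christoffelVector φ y i j

section Chart

variable (hφ : φ ∈ IsManifold.maximalAtlas (𝓡 (d + 1)) ∞ N)

include hφ

lemma chartForm_chartDeriv {q : N} (hq : q ∈ φ.source) (v w : TangentSpace (𝓡 (d + 1)) q) :
    chartForm φ (φ q) (chartDeriv φ q v) (chartDeriv φ q w) = inner ℝ v w := by
  have inner_congr {q' : N} (h : q' = q) (v w : 𝔼[d + 1]) :
      inner ℝ (E := TangentSpace (𝓡 (d + 1)) q') v w
        = inner ℝ (E := TangentSpace (𝓡 (d + 1)) q) v w := by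
    subst h
    rfl
  refine (inner_congr (φ.left_inv hq) _ _).trans ?_
  exact congrArg₂ (inner ℝ (E := TangentSpace (𝓡 (d + 1)) q))
    (chartSymmDeriv_chartDeriv hφ hq v) (chartSymmDeriv_chartDeriv hφ hq w)

lemma chartForm_transition (hψ : ψ ∈ IsManifold.maximalAtlas (𝓡 (d + 1)) ∞ N) {q : N}
    (hq : q ∈ φ.source) (hq' : q ∈ ψ.source) (a b : 𝔼[d + 1]) :
    chartForm ψ (ψ q) a b = chartForm φ (φ q) (fderiv ℝ (φ ∘ ψ.symm) (ψ q) a)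
      (fderiv ℝ (φ ∘ ψ.symm) (ψ q) b) := by
  have chart_surj (a : 𝔼[d + 1]) : ∃ v : TangentSpace (𝓡 (d + 1)) q, chartDeriv ψ q v = a :=
    ⟨_, chartDeriv_chartSymmDeriv_of_mem_source hψ hq' a⟩
  obtain ⟨v, rfl⟩ := chart_surj a
  obtain ⟨w, rfl⟩ := chart_surj b
  rw [chartForm_chartDeriv hψ hq', ← chartDeriv_eq_fderiv_transition hφ hψ hq hq',
    ← chartDeriv_eq_fderiv_transition hφ hψ hq hq', chartForm_chartDeriv hφ hq]

lemma eq_zero_of_chartForm_self {y : 𝔼[d + 1]} (hy : y ∈ φ.target) {v : 𝔼[d + 1]}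
    (hv : chartForm φ y v v = 0) : v = 0 := by
  have symm_eq_zero : chartSymmDeriv φ y v = 0 :=
    (inner_self_eq_zero (𝕜 := ℝ) (E := TangentSpace (𝓡 (d + 1)) (φ.symm y))).1 hv
  rw [← chartDeriv_chartSymmDeriv hφ hy v, symm_eq_zero, map_zero]

lemma chartGram_mul_inv {y : 𝔼[d + 1]} (hy : y ∈ φ.target) :
    chartGram φ y * (chartGram φ y)⁻¹ = 1 := by
  refine Matrix.mul_nonsing_inv _ (isUnit_iff_ne_zero.2 fun det_eq_zero => ?_)
  obtain ⟨v, v_ne, gram_v⟩ := Matrix.exists_mulVec_eq_zero_iff.2 det_eq_zero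
  have form_v : chartForm φ y (WithLp.toLp 2 v) = 0 :=
    clm_ext_single fun m => by rw [chartForm_toLp_single, gram_v]; rfl
  exact v_ne (congrArg WithLp.ofLp (eq_zero_of_chartForm_self hφ hy (by rw [form_v]; rfl)))

variable [IsManifold (𝓡 (d + 1)) ∞ N]

lemma chartDeriv_connectorIn {e : TangentBundle (𝓡 (d + 1)) N} (he : e.proj ∈ φ.source)
    (ξ : TangentSpace (𝓡 (d + 1)).tangent e) :
    chartDeriv φ e.proj (connectorIn φ e ξ) = fiberVelocity φ e ξ
      + christoffelForm φ (φ e.proj) (baseVelocity φ e ξ) (fiberCoord φ e) := by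
  refine Eq.trans ?_ (chartDeriv_chartSymmDeriv_of_mem_source hφ he _)
  refine congrArg (fun v => chartDeriv φ e.proj (chartSymmDeriv φ (φ e.proj) v)) ?_
  ext k
  simp only [christoffelForm, christoffelVector, PiLp.add_apply, WithLp.ofLp_sum,
    WithLp.ofLp_smul, Finset.sum_apply, Pi.smul_apply, smul_eq_mul]
  rfl

section Smooth

variable [IsContMDiffRiemannianBundle (𝓡 (d + 1)) ∞ 𝔼[d + 1]
    (fun q : N => TangentSpace (𝓡 (d + 1)) q)]

lemma contDiffOn_chartForm : ContDiffOn ℝ ∞ (chartForm φ) φ.target := by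
  have smooth_frame (a : 𝔼[d + 1]) : ContMDiffOn 𝓘(ℝ, 𝔼[d + 1]) (𝓡 (d + 1)).tangent ∞
      (fun z => (⟨φ.symm z, chartSymmDeriv φ z a⟩ : TangentBundle (𝓡 (d + 1)) N)) φ.target := by
    have smooth_tangentMap := (contMDiffOn_symm_of_mem_maximalAtlas hφ).contMDiffOn_tangentMapWithin
      (m := ∞) (by simp) φ.open_target.uniqueMDiffOn
    have smooth_const : ContMDiffOn 𝓘(ℝ, 𝔼[d + 1]) 𝓘(ℝ, 𝔼[d + 1]).tangent ∞
        (fun z => (⟨z, a⟩ : TangentBundle 𝓘(ℝ, 𝔼[d + 1]) 𝔼[d + 1])) φ.target := fun _ _ =>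
      contMDiffWithinAt_vectorSpace_iff_contDiffWithinAt.2 contDiffWithinAt_const
    refine (smooth_tangentMap.comp smooth_const fun z hz => hz).congr fun z hz => ?_
    simp only [Function.comp, tangentMapWithin, chartSymmDeriv]
    rw [mfderivWithin_of_isOpen φ.open_target hz]
    rfl
  refine contDiffOn_clm_apply.2 fun a => contDiffOn_clm_apply.2 fun b => ?_
  exact ((smooth_frame a).inner_bundle (smooth_frame b)
    (E := (fun q : N => TangentSpace (𝓡 (d + 1)) q))).contDiffOn

lemma differentiableAt_chartForm {y : 𝔼[d + 1]} (hy : y ∈ φ.target) :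
    DifferentiableAt ℝ (chartForm φ) y :=
  ((contDiffOn_chartForm hφ).contDiffAt (φ.open_target.mem_nhds hy)).differentiableAt (by simp)

lemma continuousAt_chartForm {y : 𝔼[d + 1]} (hy : y ∈ φ.target) : ContinuousAt (chartForm φ) y :=
  (differentiableAt_chartForm hφ hy).continuousAt

lemma fderiv_chartForm_single {y : 𝔼[d + 1]} (hy : y ∈ φ.target) (i j l : Fin (d + 1)) :
    fderiv ℝ (chartForm φ) y (EuclideanSpace.single i 1) (EuclideanSpace.single j 1)
      (EuclideanSpace.single l 1) = chartGramDeriv φ y i j l := by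
  have deriv_coeff := ((differentiableAt_chartForm hφ hy).hasFDerivAt.clm_apply
    (hasFDerivAt_const (EuclideanSpace.single j (1 : ℝ)) y)).clm_apply
      (hasFDerivAt_const (EuclideanSpace.single l (1 : ℝ)) y)
  have gram_eq : (fun z => chartGram φ z j l) = fun z =>
      chartForm φ z (EuclideanSpace.single j 1) (EuclideanSpace.single l 1) := rfl
  rw [chartGramDeriv, gram_eq, deriv_coeff.fderiv]
  simp

lemma chartForm_christoffelVector {y : 𝔼[d + 1]} (hy : y ∈ φ.target) (i j : Fin (d + 1))
    (Z : 𝔼[d + 1]) :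
    2 * chartForm φ y (christoffelVector φ y i j) Z =
      koszulForm (fderiv ℝ (chartForm φ) y) Z (EuclideanSpace.single i 1)
        (EuclideanSpace.single j 1) := by
  let lowered (m : Fin (d + 1)) : ℝ :=
    chartGramDeriv φ y i j m + chartGramDeriv φ y j i m - chartGramDeriv φ y m i j
  have christoffel_eq : christoffelVector φ y i j =
      (1 / 2 : ℝ) • WithLp.toLp 2 ((chartGram φ y)⁻¹.mulVec lowered) := rfl
  set D := fderiv ℝ (chartForm φ) y with D_def
  suffices eq_functional : (2 : ℝ) • chartForm φ y (christoffelVector φ y i j) =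
      D (EuclideanSpace.single i 1) (EuclideanSpace.single j 1)
        + D (EuclideanSpace.single j 1) (EuclideanSpace.single i 1)
        - (D.flip (EuclideanSpace.single i 1)).flip (EuclideanSpace.single j 1) from
    congrArg (fun L => L Z) eq_functional
  refine clm_ext_single fun m => ?_
  rw [christoffel_eq, map_smul, smul_smul, mul_one_div_cancel two_ne_zero, one_smul,
    chartForm_toLp_single, Matrix.mulVec_mulVec, chartGram_mul_inv hφ hy, Matrix.one_mulVec,
    sub_apply, add_apply, ContinuousLinearMap.flip_apply, ContinuousLinearMap.flip_apply, D_def,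
    fderiv_chartForm_single hφ hy, fderiv_chartForm_single hφ hy, fderiv_chartForm_single hφ hy]

lemma chartForm_christoffelForm {y : 𝔼[d + 1]} (hy : y ∈ φ.target) (Y w Z : 𝔼[d + 1]) :
    2 * chartForm φ y (christoffelForm φ y Y w) Z =
      koszulForm (fderiv ℝ (chartForm φ) y) Z Y w := by
  rw [bilinear_eq_sum (koszulForm _ Z) Y w]
  simp only [christoffelForm, map_sum, map_smul, sum_apply, smul_apply, Finset.mul_sum,
    ← chartForm_christoffelVector hφ hy, smul_eq_mul, mul_left_comm]

section Transition

variable (hψ : ψ ∈ IsManifold.maximalAtlas (𝓡 (d + 1)) ∞ N) {q : N} (hq : q ∈ φ.source)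
  (hq' : q ∈ ψ.source)

include hψ hq hq'

lemma fderiv_chartForm_transition (v a b : 𝔼[d + 1]) :
    letI τ := φ ∘ ψ.symm
    fderiv ℝ (chartForm ψ) (ψ q) v a b =
      fderiv ℝ (chartForm φ) (φ q) (fderiv ℝ τ (ψ q) v) (fderiv ℝ τ (ψ q) a) (fderiv ℝ τ (ψ q) b)
        + chartForm φ (φ q) (fderiv ℝ (fderiv ℝ τ) (ψ q) v a) (fderiv ℝ τ (ψ q) b)
        + chartForm φ (φ q) (fderiv ℝ τ (ψ q) a) (fderiv ℝ (fderiv ℝ τ) (ψ q) v b) := by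
  set τ := φ ∘ ψ.symm
  have τ_apply : τ (ψ q) = φ q := congrArg φ (ψ.left_inv hq')
  have pullback (a b : 𝔼[d + 1]) : (fun z => chartForm ψ z a b) =ᶠ[𝓝 (ψ q)]
      fun z => chartForm φ (τ z) (fderiv ℝ τ z a) (fderiv ℝ τ z b) := by
    filter_upwards [(ψ.symm.isOpen_inter_preimage φ.open_source).mem_nhds
      ⟨ψ.map_source hq', by rwa [mem_preimage, ψ.left_inv hq']⟩] with z hz
    have form_eq := chartForm_transition hφ hψ hz.2 (ψ.map_target hz.1) a b
    rwa [ψ.right_inv hz.1] at form_eq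
  have τ_mem : τ (ψ q) ∈ φ.target := τ_apply ▸ φ.map_source hq
  rw [← τ_apply]
  exact fderiv_pullback_form ((contDiffAt_transition hφ hψ hq hq').of_le (by norm_cast))
    (differentiableAt_chartForm hφ τ_mem)
    (differentiableAt_chartForm hψ (ψ.map_source hq')) pullback v a b

/-- The inhomogeneous term of the transformation law makes up for the second derivative of the
transition map in the vertical coordinates, so that the connector does not depend on the chart. -/
lemma christoffelForm_transition (Y w : 𝔼[d + 1]) :
    fderiv ℝ (fderiv ℝ (φ ∘ ψ.symm)) (ψ q) Y w
      + christoffelForm φ (φ q) (fderiv ℝ (φ ∘ ψ.symm) (ψ q) Y) (fderiv ℝ (φ ∘ ψ.symm) (ψ q) w)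
      = fderiv ℝ (φ ∘ ψ.symm) (ψ q) (christoffelForm ψ (ψ q) Y w) := by
  have second_symm (a b : 𝔼[d + 1]) : fderiv ℝ (fderiv ℝ (φ ∘ ψ.symm)) (ψ q) a b
      = fderiv ℝ (fderiv ℝ (φ ∘ ψ.symm)) (ψ q) b a :=
    ((contDiffAt_transition hφ hψ hq hq').isSymmSndFDerivAt
      (by rw [minSmoothness_of_isRCLikeNormedField]; norm_cast)).eq a b
  have form_transition := chartForm_transition hφ hψ hq hq'
  have deriv_transition := fderiv_chartForm_transition hφ hψ hq hq'
  have transition_surj (x : 𝔼[d + 1]) : ∃ Z, fderiv ℝ (φ ∘ ψ.symm) (ψ q) Z = x :=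
    ⟨_, (chartDeriv_eq_fderiv_transition hφ hψ hq hq' _).symm.trans
      (chartDeriv_chartSymmDeriv_of_mem_source hφ hq x)⟩
  set L := fderiv ℝ (φ ∘ ψ.symm) (ψ q)
  set B := fderiv ℝ (fderiv ℝ (φ ∘ ψ.symm)) (ψ q)
  have orthogonal (Z : 𝔼[d + 1]) : chartForm φ (φ q) (B Y w + christoffelForm φ (φ q) (L Y) (L w)
      - L (christoffelForm ψ (ψ q) Y w)) (L Z) = 0 := by
    have koszul_φ := chartForm_christoffelForm hφ (φ.map_source hq) (L Y) (L w) (L Z)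
    have koszul_ψ := chartForm_christoffelForm hψ (ψ.map_source hq') Y w Z
    rw [koszulForm_apply] at koszul_φ koszul_ψ
    rw [form_transition, deriv_transition, deriv_transition, deriv_transition, second_symm w Y,
      second_symm Z Y, second_symm Z w, chartForm_comm _ (L w) (B Y Z),
      chartForm_comm _ (L Y) (B w Z)] at koszul_ψ
    rw [map_sub, map_add, sub_apply, add_apply]
    linear_combination (koszul_φ - koszul_ψ) / 2
  obtain ⟨Z, hZ⟩ := transition_surj (B Y w + christoffelForm φ (φ q) (L Y) (L w)
    - L (christoffelForm ψ (ψ q) Y w))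
  exact sub_eq_zero.1 (eq_zero_of_chartForm_self hφ (φ.map_source hq) (hZ ▸ orthogonal Z))

end Transition

lemma chartDeriv_connector {e : TangentBundle (𝓡 (d + 1)) N} (he : e.proj ∈ φ.source)
    (ξ : TangentSpace (𝓡 (d + 1)).tangent e) :
    chartDeriv φ e.proj (connector e ξ) = fiberVelocity φ e ξ
      + christoffelForm φ (φ e.proj) (baseVelocity φ e ξ) (fiberCoord φ e) := by
  have hψ := IsManifold.chart_mem_maximalAtlas (I := 𝓡 (d + 1)) (n := ∞) e.proj
  have he' := mem_chart_source 𝔼[d + 1] e.proj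
  rw [connector, chartDeriv_eq_fderiv_transition hφ hψ he he', chartDeriv_connectorIn hψ he',
    map_add, ← christoffelForm_transition hφ hψ he he', ← baseVelocity_change hφ hψ he he',
    ← fiberCoord_change hφ hψ he he', fiberVelocity_change hφ hψ he he']
  abel

end Smooth

end Chart

section AlmostIsometric

variable {ε : ℝ} (h : IsAlmostIsometricChart ε φ)

include h

lemma nonneg_of_isAlmostIsometricChart {y : 𝔼[d + 1]} (hy : y ∈ φ.target) : 0 ≤ ε :=
  (abs_nonneg _).trans (h.christoffel_le y hy 0 0 0)

lemma sq_norm_le_chartForm {y : 𝔼[d + 1]} (hy : y ∈ φ.target) (v : 𝔼[d + 1]) :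
    ‖v‖ ^ 2 ≤ (1 + ε) * chartForm φ y v v := by
  have hε := nonneg_of_isAlmostIsometricChart h hy
  obtain rfl | hv := eq_or_ne v 0
  · simp
  rw [← inv_mul_le_iff₀ (by positivity), ← one_div]
  exact (h.lower y hy v hv).le

lemma norm_chartDeriv_le {q : N} (hq : q ∈ φ.source) (v : TangentSpace (𝓡 (d + 1)) q) :
    ‖chartDeriv φ q v‖ ≤ √(1 + ε) * ‖v‖ := by
  have lower := sq_norm_le_chartForm h (φ.map_source hq) (chartDeriv φ q v)
  rw [chartForm_chartDeriv h.mem_atlas hq, real_inner_self_eq_norm_sq] at lower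
  rw [← Real.sqrt_sq (norm_nonneg v), ← Real.sqrt_mul' _ (sq_nonneg _)]
  exact Real.le_sqrt_of_sq_le lower

lemma norm_fiberCoord_le {e : TangentBundle (𝓡 (d + 1)) N}
    (he : e.proj ∈ φ.source) (he1 : ‖e.snd‖ ≤ 1) : ‖fiberCoord φ e‖ ≤ √(1 + ε) :=
  (norm_chartDeriv_le h he e.snd).trans (mul_le_of_le_one_right (Real.sqrt_nonneg _) he1)

lemma norm_fderiv_transition_le {ψ : OpenPartialHomeomorph N 𝔼[d + 1]}
    (hψ : ψ ∈ IsManifold.maximalAtlas (𝓡 (d + 1)) ∞ N) {y : 𝔼[d + 1]} (hy : y ∈ ψ.target)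
    (hyφ : ψ.symm y ∈ φ.source) :
    ‖fderiv ℝ (φ ∘ ψ.symm) y‖ ≤ √((1 + ε) * ‖chartForm ψ y‖) := by
  obtain ⟨q, hq', rfl⟩ : y ∈ ψ '' ψ.source := ψ.image_source_eq_target ▸ hy
  have hq : q ∈ φ.source := ψ.left_inv hq' ▸ hyφ
  have hε := nonneg_of_isAlmostIsometricChart h (φ.map_source hq)
  refine ContinuousLinearMap.opNorm_le_bound _ (Real.sqrt_nonneg _) fun a => ?_
  rw [← Real.sqrt_sq (norm_nonneg a), ← Real.sqrt_mul' _ (sq_nonneg _)]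
  refine Real.le_sqrt_of_sq_le ((sq_norm_le_chartForm h (φ.map_source hq) _).trans ?_)
  rw [← chartForm_transition h.mem_atlas hψ hq hq', mul_assoc, sq, ← mul_assoc ‖chartForm _ _‖]
  gcongr
  exact (le_abs_self _).trans ((chartForm ψ (ψ q)).le_opNorm₂ a a)

lemma norm_christoffelVector_le {y : 𝔼[d + 1]} (hy : y ∈ φ.target) (i j : Fin (d + 1)) :
    ‖christoffelVector φ y i j‖ ≤ (d + 1) * ε := by
  rw [← sum_smul_single (christoffelVector φ y i j)]
  refine (norm_sum_le_of_le _ fun k _ => (?_ : _ ≤ ε)).trans_eq (by simp)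
  simpa [norm_smul, christoffelVector] using h.christoffel_le y hy i j k

lemma norm_christoffelForm_le {y : 𝔼[d + 1]} (hy : y ∈ φ.target) (Y w : 𝔼[d + 1]) :
    ‖christoffelForm φ y Y w‖ ≤ (d + 1) ^ 3 * ε * (‖Y‖ * ‖w‖) := by
  have summand_le (i j : Fin (d + 1)) :
      ‖(w j * Y i) • christoffelVector φ y i j‖ ≤ ‖w‖ * ‖Y‖ * ((d + 1) * ε) := by
    rw [norm_smul, norm_mul]
    gcongr
    exacts [PiLp.norm_apply_le w j, PiLp.norm_apply_le Y i, norm_christoffelVector_le h hy i j]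
  refine (norm_sum_le_of_le _ fun i _ => norm_sum_le_of_le _ fun j _ => summand_le i j).trans_eq ?_
  simp only [Finset.sum_const, Finset.card_univ, Fintype.card_fin, nsmul_eq_mul]
  push_cast
  ring

end AlmostIsometric

end Metric

/-! ## The chain rule in a chart of the tangent bundle -/

lemma eventually_notMem_or_norm_fiberCoord_lt {E : Type*} [NormedAddCommGroup E] [NormedSpace ℝ E]
    {N : Type*} [TopologicalSpace N] [T2Space N] [ChartedSpace E N] [IsManifold 𝓘(ℝ, E) ∞ N]
    {φ : OpenPartialHomeomorph N E} (hφ : φ ∈ IsManifold.maximalAtlas 𝓘(ℝ, E) ∞ N)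
    {K : Set E} (hK : IsCompact K) (hs : K ⊆ φ.target) {e : TangentBundle 𝓘(ℝ, E) N} {R : ℝ}
    (he : e.proj ∈ φ.source → ‖fiberCoord φ e‖ < R) :
    ∀ᶠ e' in 𝓝 e, e'.proj ∉ φ.symm '' K ∨ ‖fiberCoord φ e'‖ < R := by
  by_cases hes : e.proj ∈ φ.source
  · have source_mem := (bundleChart φ hφ).open_source.mem_nhds hes
    have cont := ((contMDiffOn_fiberCoord hφ).continuousOn.continuousAt source_mem).norm
    filter_upwards [cont.eventually (gt_mem_nhds (he hes))] with e' he'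
    exact .inr he'
  · have proj_notMem : e.proj ∉ φ.symm '' K := fun ⟨y, hy, hye⟩ => hes (hye ▸ φ.map_target (hs hy))
    have cont_proj := FiberBundle.continuous_proj E (TangentSpace 𝓘(ℝ, E) : N → Type _)
    filter_upwards [cont_proj.continuousAt.eventually
      ((isCompact_symm_image hK hs).isClosed.isOpen_compl.mem_nhds proj_notMem)] with e' he'
    exact .inl he'

section Colocal

variable {d : ℕ} {Q : Set 𝔼[d]} {F : Type*} [NormedAddCommGroup F] [NormedSpace ℝ F]
  [FiniteDimensional ℝ F]

lemma IsColocalWeakDeriv.hasWeakDeriv_comp {B H X : Type*} [NormedAddCommGroup B]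
    [NormedSpace ℝ B] [TopologicalSpace H] {I : ModelWithCorners ℝ B H} [TopologicalSpace X]
    [ChartedSpace H X] {u : 𝔼[d] → X} {du : ∀ x, 𝔼[d] →L[ℝ] TangentSpace I (u x)}
    (hu : IsColocalWeakDeriv I Q u du) {f : X → F} (hf : ContMDiff I 𝓘(ℝ, F) 1 f)
    (hc : HasCompactSupport f) :
    HasWeakDeriv Q (fun x => f (u x)) (fun x => (mvfderiv I f (u x)).comp (du x)) := by
  refine hasWeakDeriv_of_forall_dual fun l => ?_
  have deriv_comp (q : X) : mvfderiv I (l ∘ f) q = l.comp (mvfderiv I f q) :=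
    ((l.hasFDerivAt.hasMFDerivAt.comp q
      (hf.mdifferentiableAt one_ne_zero).hasMFDerivAt).mfderiv :)
  have weak_deriv := hu (l ∘ f) (l.contDiff.contMDiff.comp hf) (hc.comp_left (map_zero l))
  exact weak_deriv.congr_ae (ae_of_all _ fun _ => rfl) (ae_of_all _ fun x =>
    congrArg (fun L : TangentSpace I (u x) →L[ℝ] ℝ => L.comp (du x)) (deriv_comp (u x)))

variable {E : Type*} [NormedAddCommGroup E] [NormedSpace ℝ E] [FiniteDimensional ℝ E]
  {N : Type*} [TopologicalSpace N] [T2Space N] [ChartedSpace E N]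
  {φ : OpenPartialHomeomorph N E}
  {u : 𝔼[d] → N} {du : ∀ x, 𝔼[d] →L[ℝ] TangentSpace 𝓘(ℝ, E) (u x)}

lemma IsColocalWeakDeriv.nullMeasurableSet_preimage_ball
    (hu : IsColocalWeakDeriv 𝓘(ℝ, E) Q u du)
    (hφ : φ ∈ IsManifold.maximalAtlas 𝓘(ℝ, E) ∞ N) {c : E} {ρ : ℝ} (hρ : 0 < ρ)
    (hs : Metric.closedBall c ρ ⊆ φ.target) :
    NullMeasurableSet {x | u x ∈ φ.source ∧ φ (u x) ∈ Metric.ball c ρ} (volume.restrict Q) := by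
  let χ : ContDiffBump c := ⟨ρ / 2, ρ, by positivity, by linarith⟩
  have hχs : tsupport χ ⊆ φ.target := χ.tsupport_eq.trans_subset hs
  have smooth_φ := (contMDiffOn_of_mem_maximalAtlas hφ).of_le (m := 1) (by norm_cast)
  have weak_deriv := hu.hasWeakDeriv_comp (contMDiff_chartExtension smooth_φ χ.contDiff
    χ.hasCompactSupport hχs) (hasCompactSupport_chartExtension χ.hasCompactSupport hχs)
  have eq_support : {x | u x ∈ φ.source ∧ φ (u x) ∈ Metric.ball c ρ} =
      (fun x => chartExtension φ χ (u x)) ⁻¹' {0}ᶜ := by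
    ext x
    rw [← show Function.support χ = Metric.ball c ρ from χ.support_eq]
    exact indicator_apply_ne_zero.symm
  rw [eq_support]
  exact weak_deriv.1.aestronglyMeasurable.aemeasurable.nullMeasurable
    (measurableSet_singleton 0).compl

variable [IsManifold 𝓘(ℝ, E) ∞ N]
  {ν : ∀ x, TangentSpace 𝓘(ℝ, E) (u x)}
  {dν : ∀ x, 𝔼[d] →L[ℝ]
    TangentSpace 𝓘(ℝ, E).tangent (⟨u x, ν x⟩ : TangentBundle 𝓘(ℝ, E) N)}

/-- The function on `TN` need not have compact support: since the fibre coordinates of `ν` are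
bounded, it can be cut off in the fibre direction without changing it near the values of `ν`. -/
lemma IsColocalWeakDeriv.hasWeakDeriv_bundleExtension (hQ : MeasurableSet Q)
    (hν : IsColocalWeakDeriv 𝓘(ℝ, E).tangent Q
      (fun x => (⟨u x, ν x⟩ : TangentBundle 𝓘(ℝ, E) N)) dν)
    (hφ : φ ∈ IsManifold.maximalAtlas 𝓘(ℝ, E) ∞ N) {R : ℝ}
    (hR : ∀ x ∈ Q, u x ∈ φ.source → ‖fiberCoord φ ⟨u x, ν x⟩‖ ≤ R)
    {H : E × E → F} (hH : ContDiff ℝ 1 H) {K : Set E} (hK : IsCompact K) (hs : K ⊆ φ.target)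
    (hH0 : ∀ z, z.1 ∉ K → H z = 0) :
    HasWeakDeriv Q (fun x => chartExtension (bundleChart φ hφ) H ⟨u x, ν x⟩)
      (fun x => (mvfderiv 𝓘(ℝ, E).tangent (chartExtension (bundleChart φ hφ) H)
        ⟨u x, ν x⟩).comp (dν x)) := by
  have := t2Space_totalSpace (F := E) (TangentSpace 𝓘(ℝ, E) : N → Type _)
  let κ : ContDiffBump (0 : E) := ⟨|R| + 1, |R| + 2, by positivity, by linarith⟩
  let Hκ : E × E → F := fun z => κ z.2 • H z
  have Hκ_contDiff : ContDiff ℝ 1 Hκ := (κ.contDiff.comp contDiff_snd).smul hH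
  have Hκ_tsupport : tsupport Hκ ⊆ K ×ˢ tsupport κ :=
    closure_minimal (fun z hz => ⟨not_not.1 fun hzK => hz (by simp [Hκ, hH0 z hzK]),
      subset_tsupport _ fun hzκ => hz (by simp [Hκ, hzκ])⟩) (hK.isClosed.prod (isClosed_tsupport _))
  have Hκ_compact : HasCompactSupport Hκ :=
    (hK.prod κ.hasCompactSupport).of_isClosed_subset (isClosed_tsupport _) Hκ_tsupport
  have Hκ_target : tsupport Hκ ⊆ (bundleChart φ hφ).target := fun z hz =>
    ⟨hs (Hκ_tsupport hz).1, mem_univ _⟩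
  have eventuallyEq (x : 𝔼[d]) (hx : x ∈ Q) : chartExtension (bundleChart φ hφ) Hκ
      =ᶠ[𝓝 ⟨u x, ν x⟩] chartExtension (bundleChart φ hφ) H := by
    filter_upwards [eventually_notMem_or_norm_fiberCoord_lt hφ hK hs (e := ⟨u x, ν x⟩)
      (R := |R| + 1) fun hxs => (hR x hx hxs).trans_lt (by linarith [le_abs_self R])] with e he
    by_cases he' : e ∈ (bundleChart φ hφ).source
    swap
    · simp only [chartExtension, indicator_of_notMem he']
    rw [chartExtension_apply he', chartExtension_apply he']
    rcases he with he | he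
    · have H_eq_zero := hH0 (bundleChart φ hφ e) fun hK' => he ⟨_, hK', φ.left_inv he'⟩
      simp only [Hκ, H_eq_zero, smul_zero]
    · have κ_eq_one : κ (fiberCoord φ e) = 1 := κ.one_of_mem_closedBall (by simpa using he.le)
      simp only [Hκ, bundleChart_apply, κ_eq_one, one_smul]
  have smooth_bundleChart := (contMDiffOn_bundleCoord hφ).of_le (m := 1) (by norm_cast)
  refine (hν.hasWeakDeriv_comp (contMDiff_chartExtension smooth_bundleChart Hκ_contDiff Hκ_compact
    Hκ_target) (hasCompactSupport_chartExtension Hκ_compact Hκ_target)).congr hQ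
    (fun x hx => (eventuallyEq x hx).eq_of_nhds) fun x hx => ?_
  exact congrArg (fun L : TangentSpace 𝓘(ℝ, E).tangent (⟨u x, ν x⟩ : TangentBundle 𝓘(ℝ, E) N)
    →L[ℝ] F => L.comp (dν x)) (eventuallyEq x hx).mfderiv_eq

lemma IsColocalWeakDeriv.ae_baseVelocity_eq (hQ : IsOpen Q)
    (hu : IsColocalWeakDeriv 𝓘(ℝ, E) Q u du)
    (hν : IsColocalWeakDeriv 𝓘(ℝ, E).tangent Q
      (fun x => (⟨u x, ν x⟩ : TangentBundle 𝓘(ℝ, E) N)) dν)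
    (hφ : φ ∈ IsManifold.maximalAtlas 𝓘(ℝ, E) ∞ N) {R : ℝ}
    (hR : ∀ x ∈ Q, u x ∈ φ.source → ‖fiberCoord φ ⟨u x, ν x⟩‖ ≤ R) {y : E} {ρ : ℝ} (hρ : 0 < ρ)
    (hs : Metric.closedBall y ρ ⊆ φ.target) :
    ∀ᵐ x ∂volume.restrict Q, u x ∈ φ.source → φ (u x) ∈ Metric.ball y (ρ / 2) →
      (baseVelocity φ ⟨u x, ν x⟩).comp (dν x) = (chartDeriv φ (u x)).comp (du x) := by
  let χ : ContDiffBump y := ⟨ρ / 2, ρ, by positivity, by linarith⟩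
  let G : E → E := fun z => χ z • z
  have G_contDiff : ContDiff ℝ 1 G := χ.contDiff.smul contDiff_id
  have G_tsupport : tsupport G ⊆ Metric.closedBall y ρ :=
    (closure_mono (s := Function.support G) (t := Function.support χ)
      fun z hz hχ => hz (by simp [G, hχ])).trans χ.tsupport_eq.subset
  have G_compact : HasCompactSupport G :=
    (isCompact_closedBall y ρ).of_isClosed_subset (isClosed_tsupport _) G_tsupport
  have smooth_φ := (contMDiffOn_of_mem_maximalAtlas hφ).of_le (m := 1) (by norm_cast)
  have weak_deriv_u := hu.hasWeakDeriv_comp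
    (contMDiff_chartExtension smooth_φ G_contDiff G_compact (G_tsupport.trans hs))
    (hasCompactSupport_chartExtension G_compact (G_tsupport.trans hs))
  have weak_deriv_ν := hν.hasWeakDeriv_bundleExtension hQ.measurableSet hφ hR
    (G_contDiff.comp contDiff_fst) (isCompact_closedBall y ρ) hs
    fun z hz => image_eq_zero_of_notMem_tsupport (f := G) fun h => hz (G_tsupport h)
  filter_upwards [weak_deriv_ν.ae_eq hQ weak_deriv_u] with x hx hxs hxy
  have G_eq_id : G =ᶠ[𝓝 (φ (u x))] id := by
    filter_upwards [χ.eventuallyEq_one_of_mem_ball hxy] with z hz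
    simp only [G, hz, Pi.one_apply, one_smul, id]
  have fderiv_G : fderiv ℝ G (φ (u x)) = .id ℝ E := G_eq_id.fderiv_eq.trans fderiv_id
  have fderiv_G_fst : fderiv ℝ (G ∘ Prod.fst) (bundleChart φ hφ ⟨u x, ν x⟩) = .fst ℝ E E := by
    rw [fderiv_comp _ (G_contDiff.differentiable one_ne_zero _) differentiableAt_fst, fderiv_fst,
      bundleChart_apply, fderiv_G, ContinuousLinearMap.id_comp]
  rwa [mvfderiv_chartExtension hxs (hasMFDerivAt_chartDeriv hφ hxs)
      (G_contDiff.differentiable one_ne_zero _), fderiv_G,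
    mvfderiv_chartExtension (Φ := bundleChart φ hφ) hxs (hasMFDerivAt_bundleChart hφ hxs)
      ((G_contDiff.comp contDiff_fst).differentiable one_ne_zero _), fderiv_G_fst] at hx

lemma IsColocalWeakDeriv.ae_mfderiv_proj_comp_eq (hQ : IsOpen Q)
    (hu : IsColocalWeakDeriv 𝓘(ℝ, E) Q u du)
    (hν : IsColocalWeakDeriv 𝓘(ℝ, E).tangent Q
      (fun x => (⟨u x, ν x⟩ : TangentBundle 𝓘(ℝ, E) N)) dν)
    (hφ : φ ∈ IsManifold.maximalAtlas 𝓘(ℝ, E) ∞ N) {R : ℝ}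
    (hR : ∀ x ∈ Q, u x ∈ φ.source → ‖fiberCoord φ ⟨u x, ν x⟩‖ ≤ R) :
    ∀ᵐ x ∂volume.restrict Q, u x ∈ φ.source → ∀ v,
      mfderiv 𝓘(ℝ, E).tangent 𝓘(ℝ, E) (fun e : TangentBundle 𝓘(ℝ, E) N => e.proj) ⟨u x, ν x⟩
        (dν x v) = du x v := by
  have exists_closedBall (y : E) (hy : y ∈ φ.target) :
      ∃ ρ : ℝ, 0 < ρ ∧ Metric.closedBall y ρ ⊆ φ.target :=
    Metric.nhds_basis_closedBall.mem_iff.1 (φ.open_target.mem_nhds hy)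
  choose! ρ ρ_pos hρ using exists_closedBall
  obtain ⟨t, ht, t_countable, target_subset⟩ := TopologicalSpace.countable_cover_nhdsWithin
    (f := fun y => Metric.ball y (ρ y / 2)) fun y hy =>
      mem_nhdsWithin_of_mem_nhds (Metric.ball_mem_nhds y (half_pos (ρ_pos y hy)))
  filter_upwards [(ae_ball_iff t_countable).2 fun y hy =>
    hu.ae_baseVelocity_eq hQ hν hφ hR (ρ_pos y (ht hy)) (hρ y (ht hy))] with x hx hxs v
  obtain ⟨y, hy, hxy⟩ := mem_iUnion₂.1 (target_subset (φ.map_source hxs))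
  have chartDeriv_eq := congrArg (fun L => L v) (hx y hy hxs hxy)
  exact (chartSymmDeriv_chartDeriv hφ hxs _).symm.trans
    ((congrArg (chartSymmDeriv φ (φ (u x))) chartDeriv_eq).trans
      (chartSymmDeriv_chartDeriv hφ hxs _))

end Colocal

section Boundary

lemma fderiv_eq_zero_of_tendsto_nhdsWithin_support {E F : Type*} [NormedAddCommGroup E]
    [NormedSpace ℝ E] [NormedAddCommGroup F] [NormedSpace ℝ F] {g : E → F} {y : E}
    (hg : DifferentiableAt ℝ g y)
    (hd : ∀ᶠ z in 𝓝[Function.support g] y, DifferentiableAt ℝ g z)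
    (hlim : Filter.Tendsto (fderiv ℝ g) (𝓝[Function.support g] y) (𝓝 0)) :
    fderiv ℝ g y = 0 := by
  ext a
  by_contra ha
  let γ : ℝ → E := fun t => y + t • a
  have γ_zero : γ 0 = y := by simp [γ]
  have deriv_γ (t : ℝ) : HasDerivAt γ a t :=
    (((hasDerivAt_id t).smul_const a).const_add y).congr_deriv (one_smul ℝ a)
  have deriv_comp (t : ℝ) (ht : DifferentiableAt ℝ g (γ t)) :
      HasDerivAt (g ∘ γ) (fderiv ℝ g (γ t) a) t :=
    ht.hasFDerivAt.comp_hasDerivAt t (deriv_γ t)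
  have deriv_zero : HasDerivAt (g ∘ γ) (fderiv ℝ g y a) 0 := by
    simpa only [γ_zero] using deriv_comp 0 (γ_zero.symm ▸ hg)
  have tendsto_γ : Filter.Tendsto γ (𝓝[>] 0) (𝓝[Function.support g] y) :=
    tendsto_nhdsWithin_iff.2 ⟨γ_zero ▸ ((deriv_γ 0).continuousAt.tendsto.mono_left
      nhdsWithin_le_nhds), (deriv_zero.eventually_ne ha).filter_mono (nhdsGT_le_nhdsNE 0)⟩
  have diff_γ := tendsto_γ.eventually hd
  have lim_deriv : Filter.Tendsto (deriv (g ∘ γ)) (𝓝[>] 0) (𝓝 0) :=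
    ((ContinuousLinearMap.apply ℝ F a).continuous.tendsto' 0 0 rfl |>.comp
      (hlim.comp tendsto_γ)).congr' (diff_γ.mono fun t ht => (deriv_comp t ht).deriv.symm)
  exact ha ((uniqueDiffWithinAt_Ici 0).eq_deriv _ deriv_zero.hasDerivWithinAt
    (hasDerivWithinAt_Ici_of_tendsto_deriv
      (fun t ht => (deriv_comp t ht).differentiableAt.differentiableWithinAt)
      deriv_zero.continuousAt.continuousWithinAt diff_γ lim_deriv))

lemma tendsto_comp_nhdsWithin_source {X V F : Type*} [TopologicalSpace X] [T2Space X]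
    [TopologicalSpace V] [NormedAddCommGroup F] {Φ : OpenPartialHomeomorph X V} {A : V → F}
    (hA : Continuous A) (hc : HasCompactSupport A) (h0 : ∀ y ∉ Φ.target, A y = 0) {q : X}
    (hq : q ∉ Φ.source) : Filter.Tendsto (A ∘ Φ) (𝓝[Φ.source] q) (𝓝 0) := by
  refine NormedAddGroup.tendsto_nhds_zero.2 fun η hη => ?_
  let K : Set V := {y | η ≤ ‖A y‖}
  have ne_zero {y : V} (hy : y ∈ K) : A y ≠ 0 := norm_pos_iff.1 (hη.trans_le hy)
  have K_compact : IsCompact K := hc.of_isClosed_subset (isClosed_le continuous_const hA.norm)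
    fun y hy => subset_tsupport A (ne_zero hy)
  have K_target : K ⊆ Φ.target := fun y hy => not_not.1 fun hy' => ne_zero hy (h0 y hy')
  have q_notMem : q ∉ Φ.symm '' K := fun ⟨y, hy, hyq⟩ => hq (hyq ▸ Φ.map_target (K_target hy))
  filter_upwards [self_mem_nhdsWithin, mem_nhdsWithin_of_mem_nhds
    ((isCompact_symm_image K_compact K_target).isClosed.isOpen_compl.mem_nhds q_notMem)]
    with p hp hpK
  exact not_le.1 fun hle => hpK ⟨Φ p, hle, Φ.left_inv hp⟩

lemma tendsto_clm_comp_zero {α E V F W : Type*} [NormedAddCommGroup E] [NormedSpace ℝ E]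
    [NormedAddCommGroup V] [NormedSpace ℝ V] [NormedAddCommGroup F] [NormedSpace ℝ F]
    [NormedAddCommGroup W] {l : Filter α} {L : α → V →L[ℝ] F} {T : α → E →L[ℝ] V} {b : α → W}
    {b₀ : W} {c : ℝ} (hL : Filter.Tendsto L l (𝓝 0)) (hb : Filter.Tendsto b l (𝓝 b₀))
    (hT : ∀ᶠ a in l, ‖T a‖ ≤ √(c * ‖b a‖)) :
    Filter.Tendsto (fun a => (L a).comp (T a)) l (𝓝 0) := by
  refine squeeze_zero_norm' (hT.mono fun a ha => (ContinuousLinearMap.opNorm_comp_le _ _).trans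
    (mul_le_mul_of_nonneg_left ha (norm_nonneg _))) ?_
  simpa using hL.norm.mul (hb.norm.const_mul c).sqrt

lemma hasFDerivAt_chartExtension_comp_symm {E F N : Type*} [NormedAddCommGroup E] [NormedSpace ℝ E]
    [NormedAddCommGroup F] [NormedSpace ℝ F] [TopologicalSpace N] [ChartedSpace E N]
    [IsManifold 𝓘(ℝ, E) ∞ N] {φ ψ : OpenPartialHomeomorph N E}
    (hφ : φ ∈ IsManifold.maximalAtlas 𝓘(ℝ, E) ∞ N) (hψ : ψ ∈ IsManifold.maximalAtlas 𝓘(ℝ, E) ∞ N)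
    {y : E} (hy : y ∈ ψ.target) (hyφ : ψ.symm y ∈ φ.source) {G : E → F}
    (hG : DifferentiableAt ℝ G (φ (ψ.symm y))) :
    HasFDerivAt (chartExtension φ G ∘ ψ.symm)
      ((fderiv ℝ G (φ (ψ.symm y))).comp (fderiv ℝ (φ ∘ ψ.symm) y)) y := by
  have smooth_transition := contDiffAt_transition hφ hψ hyφ (ψ.map_target hy)
  rw [ψ.right_inv hy] at smooth_transition
  exact (hG.hasFDerivAt.comp y (smooth_transition.differentiableAt
    (by simp)).hasFDerivAt).congr_of_eventuallyEq
      ((ψ.symm.continuousAt hy).eventually (chartExtension_eventuallyEq hyφ))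

variable {d : ℕ} {N : Type u} [TopologicalSpace N] [T2Space N] [ChartedSpace 𝔼[d + 1] N]
  [IsManifold (𝓡 (d + 1)) ∞ N] [RiemannianBundle (fun q : N => TangentSpace (𝓡 (d + 1)) q)]
  [IsContMDiffRiemannianBundle (𝓡 (d + 1)) ∞ 𝔼[d + 1] (fun q : N => TangentSpace (𝓡 (d + 1)) q)]
  {φ : OpenPartialHomeomorph N 𝔼[d + 1]} {F : Type*} [NormedAddCommGroup F] [NormedSpace ℝ F]

set_option synthInstance.maxHeartbeats 40000 in
-- The tangent bundle instances slow down the search for the norm on bilinear forms.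
/-- Along the domain of `φ`, the differential of the transition map from `ψ` to `φ` stays bounded
near `q` because `φ` is almost isometric, and the derivative of `G` in the coordinates of `φ` tends
to zero. -/
lemma tendsto_fderiv_chartExtension_comp_symm {ε : ℝ} (h : IsAlmostIsometricChart ε φ)
    {ψ : OpenPartialHomeomorph N 𝔼[d + 1]} (hψ : ψ ∈ IsManifold.maximalAtlas (𝓡 (d + 1)) ∞ N)
    {G : 𝔼[d + 1] → F} (hG : ContDiff ℝ 1 G) (hc : HasCompactSupport G)
    (h0 : ∀ y ∉ φ.target, fderiv ℝ G y = 0) {q : N} (hq : q ∉ φ.source) (hqψ : q ∈ ψ.source) :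
    letI g := chartExtension φ G ∘ ψ.symm
    letI l := 𝓝[Function.support g] (ψ q)
    (∀ᶠ y in l, DifferentiableAt ℝ g y) ∧ Filter.Tendsto (fderiv ℝ g) l (𝓝 0) := by
  set g := chartExtension φ G ∘ ψ.symm
  set l := 𝓝[Function.support g] (ψ q)
  have hyψ : ψ q ∈ ψ.target := ψ.map_source hqψ
  have tendsto_symm : Filter.Tendsto ψ.symm l (𝓝[φ.source] q) :=
    tendsto_nhdsWithin_iff.2 ⟨ψ.left_inv hqψ ▸ ((ψ.symm.continuousAt hyψ).tendsto.mono_left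
      nhdsWithin_le_nhds), eventually_mem_nhdsWithin.mono fun y hy =>
        (indicator_apply_ne_zero.1 hy).1⟩
  have mem_domains : ∀ᶠ y in l, y ∈ ψ.target ∧ ψ.symm y ∈ φ.source :=
    (Filter.eventually_of_mem (mem_nhdsWithin_of_mem_nhds (ψ.open_target.mem_nhds hyψ))
      fun _ => id).and (tendsto_symm.eventually eventually_mem_nhdsWithin)
  have deriv_g : ∀ᶠ y in l, HasFDerivAt g
      ((fderiv ℝ G (φ (ψ.symm y))).comp (fderiv ℝ (φ ∘ ψ.symm) y)) y :=
    mem_domains.mono fun y hy => hasFDerivAt_chartExtension_comp_symm h.mem_atlas hψ hy.1 hy.2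
      (hG.differentiable one_ne_zero _)
  have lim_chartForm : Filter.Tendsto (chartForm ψ) l (𝓝 (chartForm ψ (ψ q))) :=
    (continuousAt_chartForm hψ hyψ).tendsto.mono_left nhdsWithin_le_nhds
  have lim_fderiv_G := (tendsto_comp_nhdsWithin_source (hG.continuous_fderiv one_ne_zero)
    (hc.fderiv ℝ) h0 hq).comp tendsto_symm
  have lim_comp := tendsto_clm_comp_zero (b := chartForm ψ) lim_fderiv_G lim_chartForm
    (mem_domains.mono fun y hy => norm_fderiv_transition_le h hψ hy.1 hy.2)
  exact ⟨deriv_g.mono fun y hy => hy.differentiableAt,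
    lim_comp.congr' (deriv_g.mono fun y hy => hy.fderiv.symm)⟩

/-- The chart need not extend continuously to the boundary of its domain, so the differential is
computed as a limit in a chart around the boundary point. -/
lemma mvfderiv_chartExtension_of_notMem {ε : ℝ} (h : IsAlmostIsometricChart ε φ)
    {G : 𝔼[d + 1] → F} (hG : ContDiff ℝ 1 G) (hc : HasCompactSupport G)
    (h0 : ∀ y ∉ φ.target, fderiv ℝ G y = 0) {q : N} (hq : q ∉ φ.source) :
    mvfderiv (𝓡 (d + 1)) (chartExtension φ G) q = 0 := by
  by_cases hdiff : MDifferentiableAt (𝓡 (d + 1)) 𝓘(ℝ, F) (chartExtension φ G) q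
  swap
  · exact mfderiv_zero_of_not_mdifferentiableAt hdiff
  let ψ := chartAt 𝔼[d + 1] q
  have hψ : ψ ∈ IsManifold.maximalAtlas (𝓡 (d + 1)) ∞ N := IsManifold.chart_mem_maximalAtlas q
  have hqψ : q ∈ ψ.source := mem_chart_source _ q
  let g : 𝔼[d + 1] → F := chartExtension φ G ∘ ψ.symm
  obtain ⟨eventually_diff, lim_fderiv⟩ :=
    tendsto_fderiv_chartExtension_comp_symm h hψ hG hc h0 hq hqψ
  have diff_g : DifferentiableAt ℝ g (ψ q) := by
    refine mdifferentiableAt_iff_differentiableAt.1 (MDifferentiableAt.comp (ψ q) ?_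
      ((mdifferentiable_of_mem_maximalAtlas hψ).mdifferentiableAt_symm (ψ.map_source hqψ)))
    rwa [ψ.left_inv hqψ]
  have hasFDerivAt_g : HasFDerivAt g (0 : 𝔼[d + 1] →L[ℝ] F) (ψ q) :=
    fderiv_eq_zero_of_tendsto_nhdsWithin_support diff_g eventually_diff lim_fderiv ▸
      diff_g.hasFDerivAt
  have eventuallyEq_comp : chartExtension φ G =ᶠ[𝓝 q] g ∘ ψ :=
    (ψ.eventually_left_inverse hqψ).mono fun p hp => congrArg (chartExtension φ G) hp.symm
  exact ((hasFDerivAt_g.hasMFDerivAt.comp q (hasMFDerivAt_chartDeriv hψ hqψ)).congr_of_eventuallyEq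
    eventuallyEq_comp).mfderiv

end Boundary

/-! ## The rescaled cut-off -/

section Cutoff

variable {E F : Type*} [NormedAddCommGroup E] [NormedSpace ℝ E] [NormedAddCommGroup F]
  [NormedSpace ℝ F] {θ : E → F} {s : ℝ}

/-- The rescaling `y ↦ s θ(y / s)` of `θ`, so that `extendChart θ φ s` is its composition with the
chart `φ`, extended by zero. -/
noncomputable def rescaling (θ : E → F) (s : ℝ) (y : E) : F :=
  s • θ (s⁻¹ • y)

/-- The differential of `rescaling θ s` at `z.1`, applied to `z.2`, as a function on `E × E`. -/
noncomputable def rescalingDiff (θ : E → F) (s : ℝ) (z : E × E) : F :=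
  fderiv ℝ θ (s⁻¹ • z.1) z.2

lemma contDiff_rescaling {n : WithTop ℕ∞} (hθ : ContDiff ℝ n θ) : ContDiff ℝ n (rescaling θ s) :=
  (hθ.comp (contDiff_const_smul _)).const_smul s

lemma fderiv_rescaling (hθ : Differentiable ℝ θ) (hs : s ≠ 0) (y : E) :
    fderiv ℝ (rescaling θ s) y = fderiv ℝ θ (s⁻¹ • y) := by
  have diff_comp : DifferentiableAt ℝ (fun y => θ (s⁻¹ • y)) y :=
    (hθ _).comp y (differentiableAt_id.const_smul s⁻¹)
  exact (fderiv_fun_const_smul diff_comp s).trans (by rw [fderiv_comp_smul, smul_inv_smul₀ hs])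

lemma hasCompactSupport_rescaling (hs : s ≠ 0) (hθ : HasCompactSupport θ) :
    HasCompactSupport (rescaling θ s) :=
  (hθ.comp_homeomorph (Homeomorph.smulOfNeZero s⁻¹ (inv_ne_zero hs))).smul_left (f := fun _ => s)

lemma contDiff_rescalingDiff (hθ : ContDiff ℝ 2 θ) : ContDiff ℝ 1 (rescalingDiff θ s) :=
  ((hθ.fderiv_right one_add_one_eq_two.le).comp (contDiff_fst.const_smul s⁻¹)).clm_apply
    contDiff_snd

lemma fderiv_rescalingDiff (hθ : ContDiff ℝ 2 θ) (z : E × E) :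
    fderiv ℝ (rescalingDiff θ s) z = (fderiv ℝ θ (s⁻¹ • z.1)).comp (.snd ℝ E E) +
      (ContinuousLinearMap.apply ℝ F z.2).comp
        ((s⁻¹ • fderiv ℝ (fderiv ℝ θ) (s⁻¹ • z.1)).comp (.fst ℝ E E)) := by
  have deriv_θ : HasFDerivAt (fderiv ℝ θ) (fderiv ℝ (fderiv ℝ θ) (s⁻¹ • z.1)) (s⁻¹ • z.1) :=
    ((hθ.fderiv_right one_add_one_eq_two.le).differentiable one_ne_zero _).hasFDerivAt
  refine ((deriv_θ.comp z (hasFDerivAt_fst.const_smul s⁻¹)).clm_apply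
    hasFDerivAt_snd).fderiv.trans ?_
  ext <;> simp

lemma continuousAt_rescalingDiff (hθ : ContDiff ℝ 1 θ) (hs : s ≠ 0) (z : E × E) :
    ContinuousAt (fun t => rescalingDiff θ t z) s :=
  ((hθ.continuous_fderiv one_ne_zero).continuousAt.comp
    ((continuousAt_inv₀ hs).smul continuousAt_const)).clm_apply continuousAt_const

lemma continuousAt_fderiv_rescalingDiff (hθ : ContDiff ℝ 2 θ) (hs : s ≠ 0) (z : E × E) :
    ContinuousAt (fun t => fderiv ℝ (rescalingDiff θ t) z) s := by
  have fderiv_contDiff : ContDiff ℝ 1 (fderiv ℝ θ) := hθ.fderiv_right one_add_one_eq_two.le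
  have cont_inv : ContinuousAt (fun t : ℝ => t⁻¹) s := continuousAt_inv₀ hs
  have cont_smul : ContinuousAt (fun t : ℝ => t⁻¹ • z.1) s := cont_inv.smul continuousAt_const
  simp only [fderiv_rescalingDiff hθ]
  exact ((fderiv_contDiff.continuous.continuousAt.comp cont_smul).clm_comp continuousAt_const).add
    (continuousAt_const.clm_comp ((cont_inv.smul ((fderiv_contDiff.continuous_fderiv
      one_ne_zero).continuousAt.comp cont_smul)).clm_comp continuousAt_const))

/-- `c` is the upper bound `1 / s` for the factor in front of the second derivative of `θ`, or `0`
where the second derivative vanishes. -/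
lemma norm_fderiv_rescalingDiff_le (hθ : ContDiff ℝ 2 θ) {M c : ℝ} {z : E × E}
    (h₁ : ‖fderiv ℝ θ (s⁻¹ • z.1)‖ ≤ M)
    (h₂ : ‖s⁻¹ • fderiv ℝ (fderiv ℝ θ) (s⁻¹ • z.1)‖ ≤ M * c) (v : E × E) :
    ‖fderiv ℝ (rescalingDiff θ s) z v‖ ≤ M * (c * (‖v.1‖ * ‖z.2‖) + ‖v.2‖) := by
  rw [fderiv_rescalingDiff hθ]
  calc _ ≤ ‖fderiv ℝ θ (s⁻¹ • z.1) v.2‖ +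
        ‖(s⁻¹ • fderiv ℝ (fderiv ℝ θ) (s⁻¹ • z.1)) v.1 z.2‖ := norm_add_le _ _
    _ ≤ M * ‖v.2‖ + M * c * ‖v.1‖ * ‖z.2‖ :=
      add_le_add (ContinuousLinearMap.le_of_opNorm_le _ h₁ _)
        (ContinuousLinearMap.le_of_opNorm₂_le_of_le _ h₂ le_rfl le_rfl)
    _ = M * (c * (‖v.1‖ * ‖z.2‖) + ‖v.2‖) := by ring

lemma exists_norm_fderiv_le {g : E → F} (hg : ContDiff ℝ 1 g) (hc : HasCompactSupport g) :
    ∃ M, ∀ y, ‖fderiv ℝ g y‖ ≤ M :=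
  (hc.fderiv ℝ).exists_bound_of_continuous (hg.continuous_fderiv one_ne_zero)

end Cutoff

namespace IsIdentityCutoff

variable {n : ℕ} {θ : 𝔼[n] → 𝔼[n]} (hθ : IsIdentityCutoff θ)

include hθ

lemma contDiff_two : ContDiff ℝ 2 θ := hθ.contDiff.of_le (by norm_cast)

lemma fderiv_eq_zero {y : 𝔼[n]} (hy : 2 ≤ ‖y‖) : fderiv ℝ θ y = 0 := by
  have support_fderiv_subset : Function.support (fderiv ℝ θ) ⊆ Metric.closedBall 0 2 :=
    (support_fderiv_subset ℝ).trans (closure_minimal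
      (fun z hz => Metric.ball_subset_closedBall (not_not.1 fun h => hz (hθ.eq_zero z h)))
      Metric.isClosed_closedBall)
  have support_open : IsOpen (Function.support (fderiv ℝ θ)) :=
    (hθ.contDiff.continuous_fderiv (by simp)).isOpen_support
  by_contra h
  have mem_ball := interior_maximal support_fderiv_subset support_open h
  rw [interior_closedBall _ two_ne_zero, mem_ball_zero_iff] at mem_ball
  exact hy.not_gt mem_ball

lemma fderiv_fderiv_eq_zero {y : 𝔼[n]} (hy : ‖y‖ < 1) : fderiv ℝ (fderiv ℝ θ) y = 0 := by
  have eq_id : θ =ᶠ[𝓝 y] id :=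
    Filter.eventually_of_mem (Metric.isOpen_ball.mem_nhds (mem_ball_zero_iff.2 hy)) hθ.eq_self
  have fderiv_eq_const : fderiv ℝ θ =ᶠ[𝓝 y] fun _ => .id ℝ 𝔼[n] :=
    eq_id.fderiv.trans (.of_forall fun _ => fderiv_id)
  exact fderiv_eq_const.fderiv_eq.trans (fderiv_const_apply _)

lemma exists_norm_fderiv_le :
    ∃ M, 0 ≤ M ∧ ∀ y, ‖fderiv ℝ θ y‖ ≤ M ∧ ‖fderiv ℝ (fderiv ℝ θ) y‖ ≤ M := by
  obtain ⟨M₁, h₁⟩ := _root_.exists_norm_fderiv_le (hθ.contDiff_two.of_le one_le_two)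
    hθ.hasCompactSupport
  obtain ⟨M₂, h₂⟩ := _root_.exists_norm_fderiv_le
    (hθ.contDiff_two.fderiv_right one_add_one_eq_two.le) (hθ.hasCompactSupport.fderiv ℝ)
  exact ⟨max M₁ M₂, (norm_nonneg _).trans ((h₁ 0).trans (le_max_left _ _)),
    fun y => ⟨(h₁ y).trans (le_max_left _ _), (h₂ y).trans (le_max_right _ _)⟩⟩

lemma fderiv_inv_smul_eq_zero {s : ℝ} (hs : 0 < s) {y : 𝔼[n]} (hy : y ∉ Metric.ball 0 (2 * s)) :
    fderiv ℝ θ (s⁻¹ • y) = 0 := by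
  refine hθ.fderiv_eq_zero ?_
  rw [norm_smul, norm_inv, Real.norm_of_nonneg hs.le, ← div_eq_inv_mul, le_div_iff₀ hs]
  simpa using hy

lemma norm_fderiv_rescalingDiff_le {M s : ℝ} (hs : 0 < s)
    (hM : ∀ y, ‖fderiv ℝ θ y‖ ≤ M ∧ ‖fderiv ℝ (fderiv ℝ θ) y‖ ≤ M) (z v : 𝔼[n] × 𝔼[n]) :
    ‖fderiv ℝ (rescalingDiff θ s) z v‖ ≤
      M * ((Metric.ball 0 s)ᶜ.indicator (fun _ => s⁻¹) z.1 * (‖v.1‖ * ‖z.2‖) + ‖v.2‖) := by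
  refine _root_.norm_fderiv_rescalingDiff_le hθ.contDiff_two (hM _).1 ?_ v
  rw [norm_smul, norm_inv, Real.norm_of_nonneg hs.le, mul_comm]
  by_cases hz : z.1 ∈ Metric.ball 0 s
  · have norm_lt : ‖s⁻¹ • z.1‖ < 1 := by
      rw [norm_smul, norm_inv, Real.norm_of_nonneg hs.le, ← div_eq_inv_mul, div_lt_one hs]
      exact mem_ball_zero_iff.1 hz
    rw [hθ.fderiv_fderiv_eq_zero norm_lt, indicator_of_notMem (not_not.2 hz)]
    simp
  · rw [indicator_of_mem hz]
    exact mul_le_mul_of_nonneg_right (hM _).2 (inv_nonneg.2 hs.le)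

end IsIdentityCutoff

section BundleExtension

variable {E F : Type*} [NormedAddCommGroup E] [NormedSpace ℝ E] [NormedAddCommGroup F]
  [NormedSpace ℝ F] {N : Type*} [TopologicalSpace N] [ChartedSpace E N] [IsManifold 𝓘(ℝ, E) ∞ N]
  {φ : OpenPartialHomeomorph N E}

open Classical in
/-- The differential of `chartExtension (bundleChart φ hφ) H`, set to zero outside the domain of the
chart, where the extension need not be differentiable. -/
noncomputable def bundleExtensionDeriv (φ : OpenPartialHomeomorph N E) (H : E × E → F)
    (e : TangentBundle 𝓘(ℝ, E) N) : TangentSpace 𝓘(ℝ, E).tangent e →L[ℝ] F :=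
  if e.proj ∈ φ.source then
    (fderiv ℝ H (φ e.proj, fiberCoord φ e)).comp ((baseVelocity φ e).prod (fiberVelocity φ e))
  else 0

lemma bundleExtensionDeriv_of_mem (H : E × E → F) {e : TangentBundle 𝓘(ℝ, E) N}
    (he : e.proj ∈ φ.source) : bundleExtensionDeriv φ H e =
      (fderiv ℝ H (φ e.proj, fiberCoord φ e)).comp
        ((baseVelocity φ e).prod (fiberVelocity φ e)) :=
  if_pos he

lemma bundleExtensionDeriv_of_notMem (H : E × E → F) {e : TangentBundle 𝓘(ℝ, E) N}
    (he : e.proj ∉ φ.source) : bundleExtensionDeriv φ H e = 0 :=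
  if_neg he

lemma mvfderiv_chartExtension_bundleChart [T2Space N]
    (hφ : φ ∈ IsManifold.maximalAtlas 𝓘(ℝ, E) ∞ N) {H : E × E → F} (hH : Differentiable ℝ H)
    {K : Set E} (hK : IsCompact K) (hs : K ⊆ φ.target) (hH0 : ∀ z, z.1 ∉ K → H z = 0)
    (e : TangentBundle 𝓘(ℝ, E) N) :
    mvfderiv 𝓘(ℝ, E).tangent (chartExtension (bundleChart φ hφ) H) e =
      bundleExtensionDeriv φ H e := by
  by_cases he : e.proj ∈ φ.source
  · rw [bundleExtensionDeriv_of_mem H he]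
    exact mvfderiv_chartExtension (Φ := bundleChart φ hφ) he (hasMFDerivAt_bundleChart hφ he) (hH _)
  · have eventuallyEq_zero : chartExtension (bundleChart φ hφ) H =ᶠ[𝓝 e] fun _ => 0 := by
      filter_upwards [eventually_notMem_or_norm_fiberCoord_lt hφ hK hs (R := 0)
        fun h => (he h).elim] with e' he'
      have proj_notMem := he'.resolve_right (norm_nonneg _).not_gt
      by_cases hes : e' ∈ (bundleChart φ hφ).source
      · exact (chartExtension_apply hes).trans
          (hH0 _ fun hK' => proj_notMem ⟨_, hK', φ.left_inv hes⟩)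
      · exact indicator_of_notMem hes _
    rw [bundleExtensionDeriv_of_notMem H he]
    exact eventuallyEq_zero.mfderiv_eq.trans mfderiv_const

lemma tendsto_bundleExtensionDeriv_comp {ι : Type*} {l : Filter ι} {H : ι → E × E → F}
    {H' : E × E → F} {V : Type*} [NormedAddCommGroup V] [NormedSpace ℝ V]
    {e : TangentBundle 𝓘(ℝ, E) N}
    (h : ∀ z, Filter.Tendsto (fun i => fderiv ℝ (H i) z) l (𝓝 (fderiv ℝ H' z)))
    (L : V →L[ℝ] TangentSpace 𝓘(ℝ, E).tangent e) :
    Filter.Tendsto (fun i => (bundleExtensionDeriv φ (H i) e).comp L) l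
      (𝓝 ((bundleExtensionDeriv φ H' e).comp L)) := by
  by_cases he : e.proj ∈ φ.source
  · simp only [bundleExtensionDeriv_of_mem _ he]
    exact (((ContinuousLinearMap.compL ℝ V (E × E) F).flip
      (((baseVelocity φ e).prod (fiberVelocity φ e)).comp L)).continuous.tendsto _).comp (h _)
  · simp only [bundleExtensionDeriv_of_notMem _ he]
    exact tendsto_const_nhds

end BundleExtension

section Estimate

variable {d : ℕ} {N : Type u} [TopologicalSpace N] [ChartedSpace 𝔼[d + 1] N]
  [IsManifold (𝓡 (d + 1)) ∞ N] [RiemannianBundle (fun q : N => TangentSpace (𝓡 (d + 1)) q)]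
  [IsContMDiffRiemannianBundle (𝓡 (d + 1)) ∞ 𝔼[d + 1] (fun q : N => TangentSpace (𝓡 (d + 1)) q)]
  {φ : OpenPartialHomeomorph N 𝔼[d + 1]} {ε : ℝ}

lemma norm_fiberVelocity_le (h : IsAlmostIsometricChart ε φ) {e : TangentBundle (𝓡 (d + 1)) N}
    (he : e.proj ∈ φ.source) (ξ : TangentSpace (𝓡 (d + 1)).tangent e) :
    ‖fiberVelocity φ e ξ‖ ≤ √(1 + ε) * ‖connector e ξ‖ +
      (d + 1) ^ 3 * ε * (‖baseVelocity φ e ξ‖ * ‖fiberCoord φ e‖) := by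
  rw [eq_sub_of_add_eq (chartDeriv_connector h.mem_atlas he ξ).symm]
  exact (norm_sub_le _ _).trans (add_le_add (norm_chartDeriv_le h he _)
    (norm_christoffelForm_le h (φ.map_source he) _ _))

lemma norm_bundleExtensionDeriv_le (h : IsAlmostIsometricChart ε φ) {F : Type*}
    [NormedAddCommGroup F] [NormedSpace ℝ F] {H : 𝔼[d + 1] × 𝔼[d + 1] → F} {M c : ℝ} (hM : 0 ≤ M)
    (hc : 0 ≤ c) {e : TangentBundle (𝓡 (d + 1)) N} (he : e.proj ∈ φ.source) (he1 : ‖e.snd‖ ≤ 1)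
    (hH : ∀ v, ‖fderiv ℝ H (φ e.proj, fiberCoord φ e) v‖ ≤
      M * (c * (‖v.1‖ * ‖fiberCoord φ e‖) + ‖v.2‖))
    (ξ : TangentSpace (𝓡 (d + 1)).tangent e) :
    ‖bundleExtensionDeriv φ H e ξ‖ ≤
      M * ((1 + ε) * (1 + (d + 1) ^ 3 * ε)) * ((c + 1) * ‖dProj e ξ‖ + ‖connector e ξ‖) := by
  have hε := nonneg_of_isAlmostIsometricChart h (φ.map_source he)
  have sqrt_mul_sqrt : √(1 + ε) * √(1 + ε) = 1 + ε := Real.mul_self_sqrt (by positivity)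
  have sqrt_le : √(1 + ε) ≤ 1 + ε := Real.sqrt_le_iff.2 ⟨by positivity, by nlinarith⟩
  have velocity_le : ‖baseVelocity φ e ξ‖ * ‖fiberCoord φ e‖ ≤ (1 + ε) * ‖dProj e ξ‖ := by
    refine (mul_le_mul (norm_chartDeriv_le h he (dProj e ξ)) (norm_fiberCoord_le h he he1)
      (norm_nonneg _) (by positivity)).trans_eq ?_
    rw [mul_right_comm, sqrt_mul_sqrt]
  rw [bundleExtensionDeriv_of_mem _ he, mul_assoc]
  refine (hH _).trans (mul_le_mul_of_nonneg_left ?_ hM)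
  calc _ ≤ c * (‖baseVelocity φ e ξ‖ * ‖fiberCoord φ e‖) +
        (√(1 + ε) * ‖connector e ξ‖ +
          (d + 1) ^ 3 * ε * (‖baseVelocity φ e ξ‖ * ‖fiberCoord φ e‖)) :=
      add_le_add le_rfl (norm_fiberVelocity_le h he ξ)
    _ ≤ c * ((1 + ε) * ‖dProj e ξ‖) + ((1 + ε) * ‖connector e ξ‖ +
          (d + 1) ^ 3 * ε * ((1 + ε) * ‖dProj e ξ‖)) := by gcongr
    _ ≤ _ := by
      have : 0 ≤ (1 + ε) * ((d + 1) ^ 3 * ε * (c * ‖dProj e ξ‖ + ‖connector e ξ‖)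
          + ‖dProj e ξ‖) := by positivity
      linarith

end Estimate

/-! ## The estimate of the coordinate normal -/

section Integral

lemma ofReal_rpow_le_of_le_mul_add {p A a b c y : ℝ} (hp : 1 ≤ p) (hA : 0 ≤ A) (ha : 0 ≤ a)
    (hb : 0 ≤ b) (hc : 0 ≤ c) (hy : 0 ≤ y) (h : y ≤ A * (a + b + c)) :
    ENNReal.ofReal (y ^ p) ≤ ENNReal.ofReal (A ^ p * 3 ^ (p - 1)) *
      (ENNReal.ofReal (a ^ p) + ENNReal.ofReal (b ^ p) + ENNReal.ofReal (c ^ p)) := by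
  have sum_rpow_le : (a + b + c) ^ p ≤ 3 ^ (p - 1) * (a ^ p + b ^ p + c ^ p) := by
    simpa [Fin.sum_univ_three] using
      Real.rpow_sum_le_const_mul_sum_rpow_of_nonneg Finset.univ (f := ![a, b, c]) hp
        (by simp [Fin.forall_fin_succ, ha, hb, hc])
  rw [← ENNReal.ofReal_add (by positivity) (by positivity),
    ← ENNReal.ofReal_add (by positivity) (by positivity), ← ENNReal.ofReal_mul (by positivity)]
  refine ENNReal.ofReal_le_ofReal ?_
  calc y ^ p ≤ (A * (a + b + c)) ^ p := Real.rpow_le_rpow hy h (by positivity)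
    _ = A ^ p * (a + b + c) ^ p := Real.mul_rpow hA (by positivity)
    _ ≤ A ^ p * (3 ^ (p - 1) * (a ^ p + b ^ p + c ^ p)) := by gcongr
    _ = _ := (mul_assoc _ _ _).symm

lemma lintegral_rpow_le_of_ae_le {α : Type*} [MeasurableSpace α] {μ : Measure α} {f D K : α → ℝ}
    {T : Set α} {p A c : ℝ} (hp : 1 ≤ p) (hA : 0 ≤ A) (hc : 0 ≤ c) (hT : NullMeasurableSet T μ)
    (hf : ∀ x, 0 ≤ f x) (hD : ∀ x, 0 ≤ D x) (hK : ∀ x, 0 ≤ K x) (hDm : AEMeasurable D μ)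
    (h : ∀ᵐ x ∂μ, f x ≤ A * ((T.indicator (fun _ => c) x + 1) * D x + K x)) :
    ∫⁻ x, ENNReal.ofReal (f x ^ p) ∂μ ≤ ENNReal.ofReal (A ^ p * 3 ^ (p - 1)) *
      (ENNReal.ofReal (c ^ p) * (∫⁻ x in T, ENNReal.ofReal (D x ^ p) ∂μ)
        + (∫⁻ x, ENNReal.ofReal (D x ^ p) ∂μ) + ∫⁻ x, ENNReal.ofReal (K x ^ p) ∂μ) := by
  have D_meas : AEMeasurable (fun x => ENNReal.ofReal (D x ^ p)) μ :=
    (hDm.pow_const p).ennreal_ofReal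
  have indicator_meas : AEMeasurable (fun x => ENNReal.ofReal (c ^ p) *
      T.indicator (fun x => ENNReal.ofReal (D x ^ p)) x) μ := (D_meas.indicator₀ hT).const_mul _
  have pointwise : ∀ᵐ x ∂μ, ENNReal.ofReal (f x ^ p) ≤ ENNReal.ofReal (A ^ p * 3 ^ (p - 1)) *
      (ENNReal.ofReal (c ^ p) * T.indicator (fun x => ENNReal.ofReal (D x ^ p)) x
        + ENNReal.ofReal (D x ^ p) + ENNReal.ofReal (K x ^ p)) := by
    filter_upwards [h] with x hx
    have coeff_nonneg : 0 ≤ T.indicator (fun _ => c) x := indicator_nonneg (fun _ _ => hc) x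
    refine (ofReal_rpow_le_of_le_mul_add hp hA (mul_nonneg coeff_nonneg (hD x)) (hD x) (hK x)
      (hf x) (hx.trans_eq (by ring))).trans_eq ?_
    congr 3
    by_cases hxT : x ∈ T
    · simp only [indicator_of_mem hxT, Real.mul_rpow hc (hD x),
        ENNReal.ofReal_mul (Real.rpow_nonneg hc p)]
    · simp [indicator_of_notMem hxT, Real.zero_rpow (by positivity : p ≠ 0)]
  have sum_meas : AEMeasurable (fun x => ENNReal.ofReal (c ^ p) *
      T.indicator (fun x => ENNReal.ofReal (D x ^ p)) x + ENNReal.ofReal (D x ^ p)) μ :=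
    indicator_meas.add D_meas
  refine (lintegral_mono_ae pointwise).trans_eq ?_
  rw [lintegral_const_mul' _ _ ENNReal.ofReal_ne_top,
    lintegral_add_left' sum_meas, lintegral_add_left' indicator_meas,
    lintegral_const_mul' _ _ ENNReal.ofReal_ne_top, lintegral_indicator₀ hT]

end Integral

section CoordNormal

lemma extendChart_eq_chartExtension {n : ℕ} {N : Type u} [TopologicalSpace N]
    {φ : OpenPartialHomeomorph N 𝔼[n]} (θ : 𝔼[n] → 𝔼[n]) (r : ℝ) :
    extendChart θ φ r = chartExtension φ (rescaling θ r) :=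
  open Classical in funext fun q => (indicator_apply φ.source (rescaling θ r ∘ φ) q).symm

variable {d : ℕ} {N : Type u} [TopologicalSpace N] [ChartedSpace 𝔼[d + 1] N]
  {φ : OpenPartialHomeomorph N 𝔼[d + 1]} {ε : ℝ} {θ : 𝔼[d + 1] → 𝔼[d + 1]} {u : 𝔼[d] → N}
  {ν : ∀ x, TangentSpace (𝓡 (d + 1)) (u x)}

lemma IsOrientedUnitNormal.norm_le_one
    [RiemannianBundle (fun q : N => TangentSpace (𝓡 (d + 1)) q)] {o : ManifoldOrientation d N}
    {q : N} {L : 𝔼[d] →L[ℝ] TangentSpace (𝓡 (d + 1)) q} {n : TangentSpace (𝓡 (d + 1)) q}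
    (h : IsOrientedUnitNormal o L n) : ‖n‖ ≤ 1 := by
  have finrank_le : Module.finrank ℝ (LinearMap.range L.toLinearMap) ≤ d :=
    (LinearMap.finrank_range_le L.toLinearMap).trans_eq finrank_euclideanSpace_fin
  rcases finrank_le.eq_or_lt with finrank_eq | finrank_lt
  · exact (h.1 finrank_eq).1.le
  · simp [h.2 finrank_lt]

variable [IsManifold (𝓡 (d + 1)) ∞ N]

/-- The weak derivative of `coordNormal θ φ s u ν` that the chain rule gives when `dν` is a colocal
weak derivative of `x ↦ (u x, ν x)`. -/
noncomputable def coordNormalDeriv (θ : 𝔼[d + 1] → 𝔼[d + 1])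
    (φ : OpenPartialHomeomorph N 𝔼[d + 1]) (s : ℝ)
    (dν : ∀ x, 𝔼[d] →L[ℝ]
      TangentSpace (𝓡 (d + 1)).tangent (⟨u x, ν x⟩ : TangentBundle (𝓡 (d + 1)) N)) (x : 𝔼[d]) :
    𝔼[d] →L[ℝ] 𝔼[d + 1] :=
  (bundleExtensionDeriv φ (rescalingDiff θ s) ⟨u x, ν x⟩).comp (dν x)

lemma IsIdentityCutoff.hasWeakDeriv_chartExtension_rescalingDiff [T2Space N]
    (hθ : IsIdentityCutoff θ) {Q : Set 𝔼[d]} (hQ : MeasurableSet Q)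
    {dν : ∀ x, 𝔼[d] →L[ℝ]
      TangentSpace (𝓡 (d + 1)).tangent (⟨u x, ν x⟩ : TangentBundle (𝓡 (d + 1)) N)}
    (hν : IsColocalWeakDeriv (𝓡 (d + 1)).tangent Q
      (fun x => (⟨u x, ν x⟩ : TangentBundle (𝓡 (d + 1)) N)) dν)
    (hφ : φ ∈ IsManifold.maximalAtlas (𝓡 (d + 1)) ∞ N) {R s : ℝ}
    (hR : ∀ x ∈ Q, u x ∈ φ.source → ‖fiberCoord φ ⟨u x, ν x⟩‖ ≤ R) (hs : 0 < s)
    (ht : Metric.closedBall 0 (2 * s) ⊆ φ.target) :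
    HasWeakDeriv Q (fun x => chartExtension (bundleChart φ hφ) (rescalingDiff θ s) ⟨u x, ν x⟩)
      (coordNormalDeriv θ φ s dν) := by
  have smooth : ContDiff ℝ 1 (rescalingDiff θ s) := contDiff_rescalingDiff hθ.contDiff_two
  have eq_zero (z : 𝔼[d + 1] × 𝔼[d + 1]) (hz : z.1 ∉ Metric.closedBall 0 (2 * s)) :
      rescalingDiff θ s z = 0 :=
    congrArg (fun L => L z.2) (hθ.fderiv_inv_smul_eq_zero hs
      fun hz' => hz (Metric.ball_subset_closedBall hz'))
  refine (hν.hasWeakDeriv_bundleExtension hQ hφ hR smooth (isCompact_closedBall 0 (2 * s)) ht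
    eq_zero).congr hQ (fun _ _ => rfl) fun x _ => ?_
  exact congrArg (fun L : TangentSpace (𝓡 (d + 1)).tangent
    (⟨u x, ν x⟩ : TangentBundle (𝓡 (d + 1)) N) →L[ℝ] 𝔼[d + 1] => L.comp (dν x))
    (mvfderiv_chartExtension_bundleChart hφ (smooth.differentiable one_ne_zero)
      (isCompact_closedBall 0 (2 * s)) ht eq_zero ⟨u x, ν x⟩)

variable [RiemannianBundle (fun q : N => TangentSpace (𝓡 (d + 1)) q)]

/-- The Frobenius norm `|K_TN ∘ L|_{e_d, h}` of the vertical part of a linear map `L` from `ℝᵈ` to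
a tangent space of `TN`, so that `bendingEnergy` is the integral of `connectorNorm (dν x) ^ p`. -/
noncomputable def connectorNorm {e : TangentBundle (𝓡 (d + 1)) N}
    (L : 𝔼[d] →L[ℝ] TangentSpace (𝓡 (d + 1)).tangent e) : ℝ :=
  frobeniusNorm (fun ξ => ‖connector e ξ‖) L

lemma connectorNorm_le_frobeniusNorm_sasakiNorm {e : TangentBundle (𝓡 (d + 1)) N}
    (L : 𝔼[d] →L[ℝ] TangentSpace (𝓡 (d + 1)).tangent e) :
    connectorNorm L ≤ frobeniusNorm (sasakiNorm e) L :=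
  Real.sqrt_le_sqrt (Finset.sum_le_sum fun _ _ => pow_le_pow_left₀ (norm_nonneg _)
    (Real.le_sqrt_of_sq_le (le_add_of_nonneg_left (sq_nonneg _))) 2)

lemma norm_chartExtension_rescalingDiff_le (h : IsAlmostIsometricChart ε φ) {M s : ℝ}
    (hM : ∀ y, ‖fderiv ℝ θ y‖ ≤ M) {e : TangentBundle (𝓡 (d + 1)) N} (he1 : ‖e.snd‖ ≤ 1) :
    ‖chartExtension (bundleChart φ h.mem_atlas) (rescalingDiff θ s) e‖ ≤ M * √(1 + ε) := by
  have M_nonneg : 0 ≤ M := (norm_nonneg _).trans (hM 0)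
  by_cases he : e.proj ∈ φ.source
  · rw [chartExtension_apply (Φ := bundleChart φ h.mem_atlas) he]
    exact (ContinuousLinearMap.le_of_opNorm_le _ (hM _) _).trans
      (mul_le_mul_of_nonneg_left (norm_fiberCoord_le h he he1) M_nonneg)
  · rw [chartExtension, indicator_of_notMem (s := (bundleChart φ h.mem_atlas).source) he, norm_zero]
    positivity

variable [IsContMDiffRiemannianBundle (𝓡 (d + 1)) ∞ 𝔼[d + 1]
  (fun q : N => TangentSpace (𝓡 (d + 1)) q)]

lemma coordNormal_eq_chartExtension [T2Space N] (hθ : IsIdentityCutoff θ)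
    (h : IsAlmostIsometricChart ε φ) {r : ℝ} (hr : 0 < r)
    (ht : Metric.ball 0 (2 * r) ⊆ φ.target) (x : 𝔼[d]) :
    coordNormal θ φ r u ν x =
      chartExtension (bundleChart φ h.mem_atlas) (rescalingDiff θ r) ⟨u x, ν x⟩ := by
  have smooth : ContDiff ℝ 1 θ := hθ.contDiff_two.of_le one_le_two
  have fderiv_eq := fderiv_rescaling (smooth.differentiable one_ne_zero) hr.ne'
  have coordNormal_eq : coordNormal θ φ r u ν x =
      mvfderiv (𝓡 (d + 1)) (chartExtension φ (rescaling θ r)) (u x) (ν x) :=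
    congrArg (fun f => mvfderiv (𝓡 (d + 1)) f (u x) (ν x)) (extendChart_eq_chartExtension θ r)
  rw [coordNormal_eq]
  by_cases hx : u x ∈ φ.source
  · rw [mvfderiv_chartExtension hx (hasMFDerivAt_chartDeriv h.mem_atlas hx)
      ((contDiff_rescaling smooth).differentiable one_ne_zero _), fderiv_eq]
    exact (chartExtension_apply (Φ := bundleChart φ h.mem_atlas) (G := rescalingDiff θ r)
      (q := ⟨u x, ν x⟩) hx).symm
  · rw [mvfderiv_chartExtension_of_notMem h (contDiff_rescaling smooth)
      (hasCompactSupport_rescaling hr.ne' hθ.hasCompactSupport)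
      (fun y hy => (fderiv_eq y).trans (hθ.fderiv_inv_smul_eq_zero hr fun hy' => hy (ht hy'))) hx]
    exact (indicator_of_notMem (s := (bundleChart φ h.mem_atlas).source) hx _).symm

section Sobolev

variable [T2Space N] {Q : Set 𝔼[d]} {du : ∀ x, 𝔼[d] →L[ℝ] TangentSpace (𝓡 (d + 1)) (u x)}
  {dν : ∀ x, 𝔼[d] →L[ℝ]
    TangentSpace (𝓡 (d + 1)).tangent (⟨u x, ν x⟩ : TangentBundle (𝓡 (d + 1)) N)}

lemma ae_frobeniusNorm_coordNormalDeriv_le (hθ : IsIdentityCutoff θ)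
    (h : IsAlmostIsometricChart ε φ) {M s : ℝ}
    (hM : ∀ y, ‖fderiv ℝ θ y‖ ≤ M ∧ ‖fderiv ℝ (fderiv ℝ θ) y‖ ≤ M) (hs : 0 < s) (hε : 0 ≤ ε)
    (hQ : IsOpen Q) (hu : IsColocalWeakDeriv (𝓡 (d + 1)) Q u du) (hν1 : ∀ x ∈ Q, ‖ν x‖ ≤ 1)
    (hν : IsColocalWeakDeriv (𝓡 (d + 1)).tangent Q
      (fun x => (⟨u x, ν x⟩ : TangentBundle (𝓡 (d + 1)) N)) dν) :
    ∀ᵐ x ∂volume.restrict Q,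
      frobeniusNorm (fun t : 𝔼[d + 1] => ‖t‖) (coordNormalDeriv θ φ s dν x) ≤
        M * ((1 + ε) * (1 + (d + 1) ^ 3 * ε)) *
          (({x | u x ∈ φ.source ∧ φ (u x) ∈ Metric.ball 0 s}ᶜ.indicator (fun _ => s⁻¹) x + 1) *
            derivNorm (du x) + connectorNorm (dν x)) := by
  have M_nonneg : 0 ≤ M := (norm_nonneg _).trans (hM 0).1
  filter_upwards [hu.ae_mfderiv_proj_comp_eq hQ hν h.mem_atlas
    fun x hx hxs => norm_fiberCoord_le h (e := ⟨u x, ν x⟩) hxs (hν1 x hx),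
    ae_restrict_mem hQ.measurableSet] with x dProj_eq hxQ
  set c := {x | u x ∈ φ.source ∧ φ (u x) ∈ Metric.ball 0 s}ᶜ.indicator (fun _ => s⁻¹) x
  have c_nonneg : 0 ≤ c := indicator_nonneg (fun _ _ => inv_nonneg.2 hs.le) x
  rw [mul_add, ← mul_assoc]
  refine frobeniusNorm_le_of_forall (by positivity) (by positivity) norm_nonneg fun v => ?_
  rw [mul_assoc, ← mul_add]
  by_cases hx : u x ∈ φ.source
  · have c_eq : (Metric.ball 0 s)ᶜ.indicator (fun _ => s⁻¹) (φ (u x)) = c := by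
      classical simp [c, indicator_apply, hx]
    rw [← dProj_eq hx v]
    exact norm_bundleExtensionDeriv_le h M_nonneg c_nonneg (e := ⟨u x, ν x⟩) hx (hν1 x hxQ)
      (fun w => c_eq ▸ hθ.norm_fderiv_rescalingDiff_le hs hM _ w) (dν x v)
  · rw [coordNormalDeriv, bundleExtensionDeriv_of_notMem _ hx]
    simp only [ContinuousLinearMap.zero_comp, zero_apply, norm_zero]
    positivity

lemma ae_norm_coordNormalDeriv_le (hθ : IsIdentityCutoff θ)
    (h : IsAlmostIsometricChart ε φ) {M s : ℝ}
    (hM : ∀ y, ‖fderiv ℝ θ y‖ ≤ M ∧ ‖fderiv ℝ (fderiv ℝ θ) y‖ ≤ M) (hs : 0 < s) (hε : 0 ≤ ε)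
    (hQ : IsOpen Q) (hu : IsColocalWeakDeriv (𝓡 (d + 1)) Q u du) (hν1 : ∀ x ∈ Q, ‖ν x‖ ≤ 1)
    (hν : IsColocalWeakDeriv (𝓡 (d + 1)).tangent Q
      (fun x => (⟨u x, ν x⟩ : TangentBundle (𝓡 (d + 1)) N)) dν) :
    ∀ᵐ x ∂volume.restrict Q, ‖coordNormalDeriv θ φ s dν x‖ ≤
      M * ((1 + ε) * (1 + (d + 1) ^ 3 * ε)) *
        ((s⁻¹ + 1) * derivNorm (du x) + frobeniusNorm (sasakiNorm ⟨u x, ν x⟩) (dν x)) := by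
  have M_nonneg : 0 ≤ M := (norm_nonneg _).trans (hM 0).1
  filter_upwards [ae_frobeniusNorm_coordNormalDeriv_le hθ h hM hs hε hQ hu hν1 hν] with x hx
  refine (opNorm_le_frobeniusNorm _).trans (hx.trans (mul_le_mul_of_nonneg_left
    (add_le_add (mul_le_mul_of_nonneg_right (add_le_add_left ?_ 1) (frobeniusNorm_nonneg _ _))
      (connectorNorm_le_frobeniusNorm_sasakiNorm _)) (by positivity)))
  exact indicator_le_self' (fun _ _ => inv_nonneg.2 hs.le) x

/-- The chain rule applies to every radius `s < r`, where `closedBall 0 (2 * s)` lies in the image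
of the chart; then `s` tends to `r`. -/
lemma hasWeakDeriv_coordNormal (hθ : IsIdentityCutoff θ) (h : IsAlmostIsometricChart ε φ) {r : ℝ}
    (hr : 0 < r) (ht : Metric.ball 0 (2 * r) ⊆ φ.target) (hQ : IsOpen Q) (hQfin : volume Q ≠ ⊤)
    (hu : IsColocalWeakDeriv (𝓡 (d + 1)) Q u du)
    (hdu : IntegrableOn (fun x => derivNorm (du x)) Q) (hν1 : ∀ x ∈ Q, ‖ν x‖ ≤ 1)
    (hν : IsColocalWeakDeriv (𝓡 (d + 1)).tangent Q
      (fun x => (⟨u x, ν x⟩ : TangentBundle (𝓡 (d + 1)) N)) dν)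
    (hdν : IntegrableOn (fun x => frobeniusNorm (sasakiNorm ⟨u x, ν x⟩) (dν x)) Q) :
    HasWeakDeriv Q (coordNormal θ φ r u ν) (coordNormalDeriv θ φ r dν) := by
  have hε := nonneg_of_isAlmostIsometricChart h (ht (Metric.mem_ball_self (by positivity)))
  obtain ⟨M, M_nonneg, hM⟩ := hθ.exists_norm_fderiv_le
  obtain ⟨s, -, s_mem, s_tendsto⟩ := exists_seq_strictMono_tendsto' (half_lt_self hr)
  have s_pos (k : ℕ) : 0 < s k := (half_pos hr).trans (s_mem k).1
  have weak_deriv (k : ℕ) := hθ.hasWeakDeriv_chartExtension_rescalingDiff hQ.measurableSet hν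
    h.mem_atlas (fun x hx hxs => norm_fiberCoord_le h (e := ⟨u x, ν x⟩) hxs (hν1 x hx)) (s_pos k)
    ((Metric.closedBall_subset_ball (by linarith [(s_mem k).2])).trans ht)
  refine .of_tendsto weak_deriv (fun k => (weak_deriv k).1.aestronglyMeasurable)
    (fun k => (weak_deriv k).2.1.aestronglyMeasurable)
    (integrableOn_const hQfin (C := M * √(1 + ε)))
    (((hdu.const_mul ((r / 2)⁻¹ + 1)).add hdν).const_mul
      (M * ((1 + ε) * (1 + (d + 1) ^ 3 * ε)))) (fun k => ?_) (fun k => ?_) ?_ ?_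
  · filter_upwards [ae_restrict_mem hQ.measurableSet] with x hx
    exact norm_chartExtension_rescalingDiff_le h (fun y => (hM y).1) (e := ⟨u x, ν x⟩) (hν1 x hx)
  · filter_upwards [ae_norm_coordNormalDeriv_le hθ h hM (s_pos k) hε hQ hu hν1 hν] with x hx
    exact hx.trans (mul_le_mul_of_nonneg_left (add_le_add_left (mul_le_mul_of_nonneg_right
      (add_le_add_left (inv_anti₀ (half_pos hr) (s_mem k).1.le) 1) (frobeniusNorm_nonneg _ _)) _)
      (by positivity))
  · refine .of_forall fun x => ?_
    rw [coordNormal_eq_chartExtension hθ h hr ht]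
    exact tendsto_chartExtension (fun z => (continuousAt_rescalingDiff
      (hθ.contDiff_two.of_le one_le_two) hr.ne' z).tendsto.comp s_tendsto) _
  · refine .of_forall fun x => ?_
    exact tendsto_bundleExtensionDeriv_comp (fun z => (continuousAt_fderiv_rescalingDiff
      hθ.contDiff_two hr.ne' z).tendsto.comp s_tendsto) (dν x)

lemma memLp_coordNormal (hθ : IsIdentityCutoff θ) (h : IsAlmostIsometricChart ε φ) {r : ℝ}
    (hr : 0 < r) (ht : Metric.ball 0 (2 * r) ⊆ φ.target) (hQ : MeasurableSet Q)
    (hQfin : volume Q ≠ ⊤) (hm : AEStronglyMeasurable (coordNormal θ φ r u ν) (volume.restrict Q))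
    (hν1 : ∀ x ∈ Q, ‖ν x‖ ≤ 1) (q : ℝ≥0∞) :
    MemLp (coordNormal θ φ r u ν) q (volume.restrict Q) := by
  obtain ⟨M, -, hM⟩ := hθ.exists_norm_fderiv_le
  have : IsFiniteMeasure (volume.restrict Q) := isFiniteMeasure_restrict.2 hQfin
  refine .of_bound hm (M * √(1 + ε)) ?_
  filter_upwards [ae_restrict_mem hQ] with x hx
  rw [coordNormal_eq_chartExtension hθ h hr ht]
  exact norm_chartExtension_rescalingDiff_le h (fun y => (hM y).1) (e := ⟨u x, ν x⟩) (hν1 x hx)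

lemma lintegral_frobeniusNorm_coordNormalDeriv_le (hθ : IsIdentityCutoff θ)
    (h : IsAlmostIsometricChart ε φ) {M r p : ℝ}
    (hM : ∀ y, ‖fderiv ℝ θ y‖ ≤ M ∧ ‖fderiv ℝ (fderiv ℝ θ) y‖ ≤ M) (hp : 1 ≤ p) (hr : 0 < r)
    (ht : Metric.closedBall 0 r ⊆ φ.target) (hQ : IsOpen Q)
    (hu : IsColocalWeakDeriv (𝓡 (d + 1)) Q u du)
    (hdu : AEMeasurable (fun x => derivNorm (du x)) (volume.restrict Q))
    (hν1 : ∀ x ∈ Q, ‖ν x‖ ≤ 1)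
    (hν : IsColocalWeakDeriv (𝓡 (d + 1)).tangent Q
      (fun x => (⟨u x, ν x⟩ : TangentBundle (𝓡 (d + 1)) N)) dν) :
    ∫⁻ x in Q, ENNReal.ofReal
        (frobeniusNorm (fun t : 𝔼[d + 1] => ‖t‖) (coordNormalDeriv θ φ r dν x) ^ p) ≤
      ENNReal.ofReal ((M * ((1 + ε) * (1 + (d + 1) ^ 3 * ε))) ^ p * 3 ^ (p - 1)) *
        (ENNReal.ofReal (1 / r ^ p) *
            (∫⁻ x in Q \ {x ∈ Q | u x ∈ φ.source ∧ φ (u x) ∈ Metric.ball 0 r},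
              ENNReal.ofReal (derivNorm (du x) ^ p))
          + (∫⁻ x in Q, ENNReal.ofReal (derivNorm (du x) ^ p)) + bendingEnergy p Q u ν dν) := by
  have hε := nonneg_of_isAlmostIsometricChart h (ht (Metric.mem_closedBall_self hr.le))
  have M_nonneg : 0 ≤ M := (norm_nonneg _).trans (hM 0).1
  have null_meas := (hu.nullMeasurableSet_preimage_ball h.mem_atlas hr ht).compl
  have inter_eq : {x | u x ∈ φ.source ∧ φ (u x) ∈ Metric.ball 0 r}ᶜ ∩ Q =
      Q \ {x ∈ Q | u x ∈ φ.source ∧ φ (u x) ∈ Metric.ball 0 r} := by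
    rw [inter_comm, ← sdiff_eq]
    exact sdiff_self_inter.symm
  have bound := lintegral_rpow_le_of_ae_le hp (by positivity) (inv_nonneg.2 hr.le) null_meas
    (fun _ => frobeniusNorm_nonneg _ _) (fun _ => frobeniusNorm_nonneg _ _)
    (fun _ => frobeniusNorm_nonneg _ _) hdu
    (ae_frobeniusNorm_coordNormalDeriv_le hθ h hM hr hε hQ hu hν1 hν)
  rwa [Measure.restrict_restrict₀ null_meas, inter_eq, Real.inv_rpow hr.le, ← one_div] at bound

end Sobolev

end CoordNormal

theorem lemma3p4_general (d : ℕ) (p : ℝ) (hp : 1 ≤ p) (θ : 𝔼[d + 1] → 𝔼[d + 1])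
    (hθ : IsIdentityCutoff θ) (Λ : ℝ) :
    ∃ C : ℝ≥0, ∀ (N : Type u) [TopologicalSpace N] [T2Space N] [ChartedSpace 𝔼[d + 1] N]
      [IsManifold (𝓡 (d + 1)) ∞ N]
      [RiemannianBundle (fun q : N => TangentSpace (𝓡 (d + 1)) q)]
      [IsContMDiffRiemannianBundle (𝓡 (d + 1)) ∞ 𝔼[d + 1]
        (fun q : N => TangentSpace (𝓡 (d + 1)) q)]
      (ε : ℝ) (_ : ε ≤ Λ) (φ : OpenPartialHomeomorph N 𝔼[d + 1])
      (_ : IsAlmostIsometricChart ε φ) (r : ℝ) (_ : 0 < r)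
      (_ : Metric.ball 0 (2 * r) ⊆ φ.target)
      (Q : Set 𝔼[d]) (_ : IsOpen Q) (_ : volume Q ≠ ⊤)
      (u : 𝔼[d] → N) (du : ∀ x, 𝔼[d] →L[ℝ] TangentSpace (𝓡 (d + 1)) (u x))
      (ν : ∀ x, TangentSpace (𝓡 (d + 1)) (u x))
      (dν : ∀ x, 𝔼[d] →L[ℝ]
        TangentSpace (𝓡 (d + 1)).tangent (⟨u x, ν x⟩ : TangentBundle (𝓡 (d + 1)) N))
      (_ : IsColocalWeakDeriv (𝓡 (d + 1)) Q u du)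
      (_ : MemLp (fun x => derivNorm (du x)) (ENNReal.ofReal p) (volume.restrict Q))
      (_ : ∀ x ∈ Q, ‖ν x‖ ≤ 1)
      (_ : IsColocalWeakDeriv (𝓡 (d + 1)).tangent Q
        (fun x => (⟨u x, ν x⟩ : TangentBundle (𝓡 (d + 1)) N)) dν)
      (_ : MemLp (fun x => frobeniusNorm (sasakiNorm ⟨u x, ν x⟩) (dν x)) (ENNReal.ofReal p)
        (volume.restrict Q)),
      MemLp (coordNormal θ φ r u ν) (ENNReal.ofReal p) (volume.restrict Q) ∧
      ∃ Dn : 𝔼[d] → 𝔼[d] →L[ℝ] 𝔼[d + 1],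
        HasWeakDeriv Q (coordNormal θ φ r u ν) Dn ∧
        MemLp Dn (ENNReal.ofReal p) (volume.restrict Q) ∧
        ∫⁻ x in Q, ENNReal.ofReal (frobeniusNorm (fun t : 𝔼[d + 1] => ‖t‖) (Dn x) ^ p) ≤
          C * (ENNReal.ofReal (1 / r ^ p) *
                (∫⁻ x in Q \ {x ∈ Q | u x ∈ φ.source ∧ φ (u x) ∈ Metric.ball 0 r},
                  ENNReal.ofReal (derivNorm (du x) ^ p))
              + (∫⁻ x in Q, ENNReal.ofReal (derivNorm (du x) ^ p))
              + bendingEnergy p Q u ν dν) := by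
  obtain ⟨M, M_nonneg, hM⟩ := hθ.exists_norm_fderiv_le
  refine ⟨((M * ((1 + Λ) * (1 + (d + 1) ^ 3 * Λ))) ^ p * 3 ^ (p - 1)).toNNReal, ?_⟩
  intro N _ _ _ _ _ _ ε hεΛ φ hφ r hr ht Q hQ hQfin u du ν dν hu hdu hν1 hν hdν
  have hε := nonneg_of_isAlmostIsometricChart hφ (ht (Metric.mem_ball_self (by positivity)))
  have hΛ : 0 ≤ Λ := hε.trans hεΛ
  have : IsFiniteMeasure (volume.restrict Q) := isFiniteMeasure_restrict.2 hQfin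
  have one_le_p : 1 ≤ ENNReal.ofReal p := ENNReal.one_le_ofReal.2 hp
  have weak_deriv := hasWeakDeriv_coordNormal hθ hφ hr ht hQ hQfin hu (hdu.integrable one_le_p)
    hν1 hν (hdν.integrable one_le_p)
  refine ⟨memLp_coordNormal hθ hφ hr ht hQ.measurableSet hQfin weak_deriv.1.aestronglyMeasurable
    hν1 _, coordNormalDeriv θ φ r dν, weak_deriv, ?_, ?_⟩
  · exact (((hdu.const_mul (r⁻¹ + 1)).add hdν).const_mul _).mono'
      weak_deriv.2.1.aestronglyMeasurable
      (ae_norm_coordNormalDeriv_le hθ hφ hM hr hε hQ hu hν1 hν)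
  · refine (lintegral_frobeniusNorm_coordNormalDeriv_le hθ hφ hM hp hr
      ((Metric.closedBall_subset_ball (by linarith)).trans ht) hQ hu
      hdu.aestronglyMeasurable.aemeasurable hν1 hν).trans ?_
    refine mul_le_mul_left (ENNReal.ofReal_le_ofReal ?_) _
    gcongr

theorem lemma3p4 (d : ℕ) (p : ℝ) (hp : 1 < p)
    (θ : EuclideanSpace ℝ (Fin (d + 1)) → EuclideanSpace ℝ (Fin (d + 1)))
    (hθ : IsIdentityCutoff θ) :
    ∃ C : ℝ≥0, ∀ (N : Type u) [TopologicalSpace N] [T2Space N] [SecondCountableTopology N]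
      [ChartedSpace (EuclideanSpace ℝ (Fin (d + 1))) N] [IsManifold (𝓡 (d + 1)) ∞ N]
      [RiemannianBundle (fun q : N => TangentSpace (𝓡 (d + 1)) q)]
      [IsContMDiffRiemannianBundle (𝓡 (d + 1)) ∞ (EuclideanSpace ℝ (Fin (d + 1)))
        (fun q : N => TangentSpace (𝓡 (d + 1)) q)]
      (o : ManifoldOrientation d N)
      (ε : ℝ) (_ : 0 < ε) (_ : ε < 1)
      (φ : OpenPartialHomeomorph N (EuclideanSpace ℝ (Fin (d + 1))))
      (_ : IsAlmostIsometricChart ε φ)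
      (r : ℝ) (_ : 0 < r)
      (_ : Metric.ball (0 : EuclideanSpace ℝ (Fin (d + 1))) (2 * r) ⊆ φ.target)
      (Q : Set (EuclideanSpace ℝ (Fin d))) (_ : IsOpenCube Q)
      (u : EuclideanSpace ℝ (Fin d) → N)
      (du : ∀ x, EuclideanSpace ℝ (Fin d) →L[ℝ] TangentSpace (𝓡 (d + 1)) (u x))
      (ν : ∀ x, TangentSpace (𝓡 (d + 1)) (u x))
      (dν : ∀ x, EuclideanSpace ℝ (Fin d) →L[ℝ]
        TangentSpace (𝓡 (d + 1)).tangent (⟨u x, ν x⟩ : TangentBundle (𝓡 (d + 1)) N))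
      (_ : IsSobolevImmersion p o Q u du ν dν)
      (F : Set (EuclideanSpace ℝ (Fin d)))
      (_ : F = {x ∈ Q | u x ∈ φ.source ∧
        φ (u x) ∈ Metric.ball (0 : EuclideanSpace ℝ (Fin (d + 1))) r}),
      MemLp (coordNormal θ φ r u ν) (ENNReal.ofReal p) (volume.restrict Q) ∧
      ∃ Dn : EuclideanSpace ℝ (Fin d) →
          EuclideanSpace ℝ (Fin d) →L[ℝ] EuclideanSpace ℝ (Fin (d + 1)),
        HasWeakDeriv Q (coordNormal θ φ r u ν) Dn ∧
        MemLp Dn (ENNReal.ofReal p) (volume.restrict Q) ∧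
        ∫⁻ x in Q, ENNReal.ofReal (frobeniusNorm (fun t : EuclideanSpace ℝ (Fin (d + 1)) => ‖t‖) (Dn x) ^ p) ≤
          C * (ENNReal.ofReal (1 / r ^ p) *
                (∫⁻ x in Q \ F, ENNReal.ofReal (derivNorm (du x) ^ p))
              + (∫⁻ x in Q, ENNReal.ofReal (derivNorm (du x) ^ p))
              + bendingEnergy p Q u ν dν) := by
  obtain ⟨C, hC⟩ := lemma3p4_general d p hp.le θ hθ 1
  refine ⟨C, fun N _ _ _ _ _ _ _ o ε _ hε φ hφ r hr ht Q hQ u du ν dν hu F hF => ?_⟩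
  exact hF ▸ hC N ε hε.le φ hφ r hr ht Q hQ.isOpen hQ.isBounded.measure_lt_top.ne u du ν dν
    hu.deriv_map hu.memLp_map (fun x hx => (hu.normal x hx).norm_le_one) hu.deriv_normal
    hu.memLp_normal
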